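/- Let $d\in\{2,3\}$, $k\ge 1$, and let $\Omega\subset\mathbb R^d$ be a bounded domain. Let $\Omega^-$ be open with $\overline{\Omega^-}\subset\Omega$ and with boundary $\Gamma$, where $\Omega^-=\{\varphi<0\}$ and $\Gamma=\{\varphi=0\}$ for some $\varphi\in C^2(\mathbb R^d)$ with $\nabla\varphi\neq0$ on $\Gamma$; put $\Omega^+=\Omega\setminus\overline{\Omega^-}$, let $\mathbf n$ be the unit normal on $\Gamma$ pointing out of $\Omega^-$ and $\mathbf P=\mathbf I-\mathbf n\mathbf n^T$. Let $\mathcal T_h$ be a conforming, shape regular triangulation of $\Omega$ into open simplices $T$ with diameters $h_T$, and $h=\max_T h_T$. Put $\mathcal T_h^\pm=\{T: T\cap\Omega^\pm\ne\emptyset\}$, $\Omega_h^\pm=\mathrm{int}\bigcup_{T\in\mathcal T_h^\pm}\overline T$ and $\mathcal T_h^\Gamma=\{T:\overline T\cap\Gamma\neq\emptyset\}$; assume that $\mathcal T_h^\Gamma$ is quasi-uniform and that $\Gamma\cap\partial T$ has zero surface measure for every $T$. Let $\mathcal E_h^{\Gamma,\pm}$ be the set of facets $e$ shared by two elements $T_1,T_2\in\mathcal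 T_h^\pm$ at least one of which meets $\Gamma$, let $h_e=\operatorname{diam} e$, and let $\omega_e$ be the patch $T_1\cup T_2$. Let $V_h^\pm$ be the set of pairs $\mathbf u=(\mathbf u^-,\mathbf u^+)$ with $\mathbf u^\pm\in C(\Omega_h^\pm)^d$ and $\mathbf u^\pm|_T$ polynomial of degree at most $k+1$ for each $T\in\mathcal T_h^\pm$. Write $\mathbf D(\mathbf u)=\frac12(\nabla\mathbf u+\nabla\mathbf u^T)$, $[a]=a^--a^+$ and $\{a\}=a^-$ on $\Gamma$ (so $\{\mu\}=\mu_-$). For $0<\mu_-\le\mu_+$, $f\ge0$, $\gamma>0$ and fixed $\gamma_{\mathbf u}^\pm>0$ let $$\begin{aligned}a_h(\mathbf u,\mathbf v)={}&2\mu_-(\mathbf D(\mathbf u^-),\mathbf D(\mathbf v^-))_{\Omega^-}+2\mu_+(\mathbf D(\mathbf u^+),\mathbf D(\mathbf v^+))_{\Omega^+}+f\langle[\mathbf P\mathbf u],[\mathbf P\mathbf v]\rangle_\Gamma\\&-2\langle\{\mu\,\mathbf n^T\mathbf D(\mathbf u)\mathbf n\},[\mathbf v\cdot\mathbf n]\rangle_\Gamma-2\langle\{\mu\,\mathbf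 n^T\mathbf D(\mathbf v)\mathbf n\},[\mathbf u\cdot\mathbf n]\rangle_\Gamma+\sum_{T\in\mathcal T_h^\Gamma}\frac{\gamma}{h_T}\{\mu\}\langle[\mathbf u\cdot\mathbf n],[\mathbf v\cdot\mathbf n]\rangle_{\Gamma\cap T}\\&+\mu_-\mathbf J_h^-(\mathbf u,\mathbf v)+\mu_+\mathbf J_h^+(\mathbf u,\mathbf v),\\ \mathbf J_h^\pm(\mathbf u,\mathbf v)={}&\gamma_{\mathbf u}^\pm\sum_{e\in\mathcal E_h^{\Gamma,\pm}}\frac1{h_e^2}\int_{\omega_e}(\mathbf u_1^e-\mathbf u_2^e)\cdot(\mathbf v_1^e-\mathbf v_2^e)\,dx,\end{aligned}$$ where $\mathbf u_i^e$ is the polynomial extension of $\mathbf u^\pm|_{T_i}$ to $\mathbb R^d$. Then there are $\gamma_0>0$ and $C>0$ such that for all $\gamma\ge\gamma_0$ and all $\mathbf u_h\in V_h^\pm$ $$a_h(\mathbf u_h,\mathbf u_h)\ge C\Big(\mu_-\|\mathbf D(\mathbf u_h^-)\|_{\Omega_h^-}^2+\mu_+\|\mathbf D(\mathbf u_h^+)\|_{\Omega_h^+}^2+h^{-1}\|\{\mu\}^{1/2}[\mathbf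 u_h\cdot\mathbf n]\|_\Gamma^2+f\,\|[\mathbf P\mathbf u_h]\|_\Gamma^2\Big).$$ Here $\gamma_0$ and $C$ depend only on $d$, $k$, $\Omega$, the shape of $\Gamma$, a positive lower bound for the distance of $\overline{\Omega^-}$ to $\mathbb R^d\setminus\Omega$, the constants of shape regularity and quasi-uniformity, and $\gamma_{\mathbf u}^\pm$. They do not depend on $\mu_\pm$, $f$, $h$, the mesh, or the position of $\Gamma$ relative to it (they are the same for all rigid motions of $\Omega^-$ that respect the lower bound on the distance). -/

import Mathlib

open MeasureTheory Set
open scoped MeasureTheory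

noncomputable section

namespace TwoPhaseStokes

/-- Points (and vectors) of `ℝ^d` with the Euclidean norm. -/
abbrev Pt (d : ℕ) : Type := EuclideanSpace ℝ (Fin d)

variable {d : ℕ}

/-! ### Interface and phases

The interface is the regular zero level of a function `φ`, negative in the inner phase `Ω⁻` and
positive in the outer phase `Ω⁺`. -/

/-- The inner phase `Ω⁻`. -/
def phaseMinus (φ : Pt d → ℝ) : Set (Pt d) := {x | φ x < 0}

/-- The outer phase `Ω⁺`. -/
def phasePlus (Ω : Set (Pt d)) (φ : Pt d → ℝ) : Set (Pt d) := {x ∈ Ω | 0 < φ x}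

/-- The interface `Γ`. -/
def interface (φ : Pt d → ℝ) : Set (Pt d) := {x | φ x = 0}

/-- The unit normal `n` on `Γ` pointing out of `Ω⁻`. -/
def normal (φ : Pt d → ℝ) (x : Pt d) : Pt d := ‖gradient φ x‖⁻¹ • gradient φ x

/-- The tangential projection `P v = v - (v · n) n`. -/
def tang (n v : Pt d) : Pt d := v - (inner ℝ v n) • n

/-! ### Triangulations -/

/-- The open simplex `T` with vertex set `s`. -/
def cell (s : Finset (Pt d)) : Set (Pt d) := interior (convexHull ℝ (s : Set (Pt d)))

/-- The diameter of the (closed) simplex with vertex set `s`; this is `h_T` for an element and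
`h_e` for a facet. -/
def size (s : Finset (Pt d)) : ℝ := Metric.diam (convexHull ℝ (s : Set (Pt d)))

/-- A conforming simplicial triangulation of `Ω`. Elements are given by their vertex sets. -/
structure Triangulation (Ω : Set (Pt d)) where
  elements : Finset (Finset (Pt d))
  card_eq : ∀ s ∈ elements, s.card = d + 1
  affineIndependent : ∀ s ∈ elements, AffineIndependent ℝ ((↑) : s → Pt d)
  inter_eq : ∀ s ∈ elements, ∀ t ∈ elements,
    convexHull ℝ (s : Set (Pt d)) ∩ convexHull ℝ (t : Set (Pt d))
      = convexHull ℝ ((s : Set (Pt d)) ∩ (t : Set (Pt d)))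
  cover : ⋃ s ∈ elements, convexHull ℝ (s : Set (Pt d)) = closure Ω
  cell_subset : ∀ s ∈ elements, cell s ⊆ Ω

variable {Ω : Set (Pt d)}

/-- The mesh size `h = max_T h_T`. -/
def meshSize (𝒯 : Triangulation Ω) : ℝ := sSup (size '' (𝒯.elements : Set (Finset (Pt d))))

/-- Shape regularity with constant `σ`: each `T` contains a ball of radius `h_T / σ`. -/
def ShapeRegular (σ : ℝ) (𝒯 : Triangulation Ω) : Prop :=
  ∀ s ∈ 𝒯.elements, ∃ x, Metric.ball x (size s / σ) ⊆ cell s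

open Classical in
/-- The elements `T` with `T ∩ ω ≠ ∅`; for `ω = Ω^±` this is `𝒯_h^±`. -/
def elementsMeeting (𝒯 : Triangulation Ω) (ω : Set (Pt d)) : Finset (Finset (Pt d)) :=
  𝒯.elements.filter fun s => (cell s ∩ ω).Nonempty

open Classical in
/-- `𝒯_h^Γ`: the elements whose closure intersects `Γ`. -/
def cutElements (𝒯 : Triangulation Ω) (Γ : Set (Pt d)) : Finset (Finset (Pt d)) :=
  𝒯.elements.filter fun s => (closure (cell s) ∩ Γ).Nonempty

/-- Quasi-uniformity of `𝒯_h^Γ` with constant `ρ`. -/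
def CutQuasiUniform (ρ : ℝ) (𝒯 : Triangulation Ω) (Γ : Set (Pt d)) : Prop :=
  ∀ s ∈ cutElements 𝒯 Γ, ∀ t ∈ cutElements 𝒯 Γ, size s ≤ ρ * size t

/-- The extended domain `Ω_h^±` (for `ω = Ω^±`). -/
def extDomain (𝒯 : Triangulation Ω) (ω : Set (Pt d)) : Set (Pt d) :=
  interior (⋃ s ∈ elementsMeeting 𝒯 ω, closure (cell s))

open Classical in
/-- Ordered pairs `(T₁, T₂)` of elements of `𝒯_h^±` (for `ω = Ω^±`) that share a facet and at
least one of which is cut by `Γ`. Each facet of `ℰ_h^{Γ,±}` gives exactly two such pairs. -/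
def facetPairs (𝒯 : Triangulation Ω) (ω Γ : Set (Pt d)) :
    Finset (Finset (Pt d) × Finset (Pt d)) :=
  (elementsMeeting 𝒯 ω ×ˢ elementsMeeting 𝒯 ω).filter fun p =>
    (p.1 ∩ p.2).card = d ∧ ((cell p.1 ∩ Γ).Nonempty ∨ (cell p.2 ∩ Γ).Nonempty)

/-! ### Finite element functions -/

/-- Vector-valued polynomial maps of degree at most `m`. -/
def IsPolyMap (m : ℕ) (p : Pt d → Pt d) : Prop :=
  ∃ P : Fin d → MvPolynomial (Fin d) ℝ, (∀ i, (P i).totalDegree ≤ m) ∧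
    ∀ x i, p x i = MvPolynomial.eval (fun j => x j) (P i)

/-- `u ∈ C(Ω_h^±)^d` with `u|_T ∈ P_m(T)^d` for all `T ∈ 𝒯_h^±` (for `ω = Ω^±`). -/
def IsFE (m : ℕ) (𝒯 : Triangulation Ω) (ω : Set (Pt d)) (u : Pt d → Pt d) : Prop :=
  ContinuousOn u (extDomain 𝒯 ω) ∧
    ∀ s ∈ elementsMeeting 𝒯 ω, ∃ p, IsPolyMap m p ∧ EqOn u p (cell s)

/-- The canonical extension to `ℝ^d` of the polynomial map `u|_T` of degree at most `m`, where `T`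
is the element with vertex set `s`. -/
def polyExt (m : ℕ) (s : Finset (Pt d)) (u : Pt d → Pt d) : Pt d → Pt d :=
  Classical.epsilon fun p => IsPolyMap m p ∧ EqOn u p (cell s)

/-- A pair `u = (u⁻, u⁺)`. -/
structure Field (d : ℕ) where
  minus : Pt d → Pt d
  plus : Pt d → Pt d

/-- The two-phase velocity space `V_h^±` with pieces of degree at most `m` (`m = k + 1`). -/
def IsVh (m : ℕ) (𝒯 : Triangulation Ω) (φ : Pt d → ℝ) (u : Field d) : Prop :=
  IsFE m 𝒯 (phaseMinus φ) u.minus ∧ IsFE m 𝒯 (phasePlus Ω φ) u.plus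

/-- The symmetric gradient `D(u) = (∇u + ∇uᵀ) / 2`. -/
def symGrad (u : Pt d → Pt d) (x : Pt d) : Matrix (Fin d) (Fin d) ℝ := fun i j =>
  (fderiv ℝ u x (EuclideanSpace.single j 1) i + fderiv ℝ u x (EuclideanSpace.single i 1) j) / 2

/-- The Frobenius product `A : B`. -/
def frob (A B : Matrix (Fin d) (Fin d) ℝ) : ℝ := ∑ i, ∑ j, A i j * B i j

/-- `nᵀ D(u) n` at `x`. -/
def normalStrain (φ : Pt d → ℝ) (u : Pt d → Pt d) (x : Pt d) : ℝ :=
  ∑ i, ∑ j, normal φ x i * symGrad u x i j * normal φ x j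

/-- The jump `[u · n] = u⁻ · n - u⁺ · n`. -/
def jumpNormal (φ : Pt d → ℝ) (u : Field d) (x : Pt d) : ℝ :=
  inner ℝ (u.minus x) (normal φ x) - inner ℝ (u.plus x) (normal φ x)

/-- The jump `[P u] = P u⁻ - P u⁺`. -/
def jumpTang (φ : Pt d → ℝ) (u : Field d) (x : Pt d) : Pt d :=
  tang (normal φ x) (u.minus x) - tang (normal φ x) (u.plus x)

/-! ### Bilinear forms -/

/-- The physical and numerical parameters: viscosities `μ_-`, `μ_+`, slip coefficient `f`, Nitsche
parameter `γ`, ghost penalty parameters `γ_u^-`, `γ_u^+`, and the weights `α`, `β` of the average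
`{a} = α a⁺ + β a⁻`. -/
structure Params where
  μm : ℝ
  μp : ℝ
  f : ℝ
  γ : ℝ
  γum : ℝ
  γup : ℝ
  α : ℝ
  β : ℝ

/-- The average `{a} = α a⁺ + β a⁻`. -/
def Params.avg (c : Params) (am ap : ℝ) : ℝ := c.α * ap + c.β * am

/-- The flux average `{μ nᵀ D(u) n}` at `x`. -/
def avgFlux (c : Params) (φ : Pt d → ℝ) (u : Field d) (x : Pt d) : ℝ :=
  c.avg (c.μm * normalStrain φ u.minus x) (c.μp * normalStrain φ u.plus x)

/-- The form `a_i`. Surface integrals are with respect to the `(d-1)`-dimensional Hausdorff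
measure, normalized to agree with surface area. -/
def aI (c : Params) (Ω : Set (Pt d)) (φ : Pt d → ℝ) (u v : Field d) : ℝ :=
  2 * (∫ x in phaseMinus φ, c.μm * frob (symGrad u.minus x) (symGrad v.minus x))
    + 2 * (∫ x in phasePlus Ω φ, c.μp * frob (symGrad u.plus x) (symGrad v.plus x))
    + (∫ x in interface φ, c.f * inner ℝ (jumpTang φ u x) (jumpTang φ v x) ∂μHE[d - 1])
    - 2 * (∫ x in interface φ, avgFlux c φ u x * jumpNormal φ v x ∂μHE[d - 1])

/-- The Nitsche form `a_n`. -/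
def aN (c : Params) (𝒯 : Triangulation Ω) (φ : Pt d → ℝ) (u v : Field d) : ℝ :=
  (∑ s ∈ cutElements 𝒯 (interface φ), c.γ / size s * c.avg c.μm c.μp *
      ∫ x in interface φ ∩ cell s, jumpNormal φ u x * jumpNormal φ v x ∂μHE[d - 1])
    - 2 * (∫ x in interface φ, avgFlux c φ v x * jumpNormal φ u x ∂μHE[d - 1])

open Classical in
/-- The ghost penalty form `J_h^±` (for `ω = Ω^±`, with parameter `γu = γ_u^±`). The factor `1/2`
compensates that every facet `e` occurs as two ordered pairs `(T₁, T₂)`; the facet is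
`e = T₁ ∩ T₂` and the facet patch is `ω_e = T₁ ∪ T₂`. -/
def ghostForm (γu : ℝ) (m : ℕ) (𝒯 : Triangulation Ω) (ω Γ : Set (Pt d))
    (u v : Pt d → Pt d) : ℝ :=
  γu * ((1 / 2) * ∑ p ∈ facetPairs 𝒯 ω Γ, 1 / (size (p.1 ∩ p.2)) ^ 2 *
      ∫ x in cell p.1 ∪ cell p.2,
        inner ℝ (polyExt m p.1 u x - polyExt m p.2 u x) (polyExt m p.1 v x - polyExt m p.2 v x))

/-- The velocity penalty form `a_p`. -/
def aP (c : Params) (m : ℕ) (𝒯 : Triangulation Ω) (φ : Pt d → ℝ) (u v : Field d) : ℝ :=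
  c.μm * ghostForm c.γum m 𝒯 (phaseMinus φ) (interface φ) u.minus v.minus
    + c.μp * ghostForm c.γup m 𝒯 (phasePlus Ω φ) (interface φ) u.plus v.plus

/-- The form `a_h = a_i + a_n + a_p`. -/
def aH (c : Params) (m : ℕ) (𝒯 : Triangulation Ω) (φ : Pt d → ℝ) (u v : Field d) : ℝ :=
  aI c Ω φ u v + aN c 𝒯 φ u v + aP c m 𝒯 φ u v

/-- `μ_- ‖D(u⁻)‖²_{Ω_h^-} + μ_+ ‖D(u⁺)‖²_{Ω_h^+} + h⁻¹ ‖{μ}^{1/2} [u · n]‖²_Γ + f ‖[P u]‖²_Γ`. -/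
def energySq (c : Params) (𝒯 : Triangulation Ω) (φ : Pt d → ℝ) (u : Field d) : ℝ :=
  c.μm * (∫ x in extDomain 𝒯 (phaseMinus φ), frob (symGrad u.minus x) (symGrad u.minus x))
    + c.μp * (∫ x in extDomain 𝒯 (phasePlus Ω φ), frob (symGrad u.plus x) (symGrad u.plus x))
    + (meshSize 𝒯)⁻¹ *
        (∫ x in interface φ, (√(c.avg c.μm c.μp) * jumpNormal φ u x) ^ 2 ∂μHE[d - 1])
    + c.f * (∫ x in interface φ, ‖jumpTang φ u x‖ ^ 2 ∂μHE[d - 1])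

end TwoPhaseStokes

end

/-! In `a_h(u,u)` every contribution has a sign except the consistency term `-4 ∫_Γ μ₋ (nᵀD(u⁻)n)
[u·n]`. Young's inequality with weight `η h_T` on each element splits it into `η h_T ‖nᵀD(u⁻)n‖²`
and `(η h_T)⁻¹ ‖[u·n]‖²` on `Γ ∩ T`. The second piece is absorbed by the Nitsche penalty for large
`γ`. The first is bounded through a discrete trace inequality (`exists_trace_bound`) by the strain
on the whole element `T`. That strain is not controlled by the strain in `Ω⁻` alone when `Γ` cuts
off a sliver, and this is what the ghost penalty repairs (`exists_ghost_bound`). Because the average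
takes only the inner value, the absorption happens within the terms carrying `μ₋`, and the constants
do not see the viscosity contrast. Only symmetric gradients are compared, so no Korn inequality is
needed.

The ghost estimate rests on chains of elements. At a point of `Γ` in a crossed element, a cone of
size comparable to the mesh lies in the phase (`exists_cone`). Walking through facets of elements
that meet this cone, one reaches after boundedly many steps an element containing a ball in the
phase of radius comparable to the mesh size (`IsResolved.exists_chain`). Crossing a facet changes
the polynomial strain by an amount that an inverse estimate bounds by the ghost term of that facet;
on the last element the strain is bounded by its integral over the ball. Summing over crossed
elements costs a bounded overlap factor, obtained from packing.

Independence of the cut position comes from three facts: the inverse estimates (`exists_poly_bound`)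
live on balls inside elements and never on cut pieces; the surface measure of `Γ` in a ball of
radius `r` is at most `A r^(d-1)`; cone size and `A` depend on the shape of `Γ` only and are
invariant under isometries (`exists_interface_geometry`). -/

namespace TwoPhaseStokes

/-! ### Polynomial functions -/

/-- The space of real polynomial functions of total degree at most `m`. -/
noncomputable def polyFun (d m : ℕ) : Submodule ℝ (Pt d → ℝ) :=
  (MvPolynomial.restrictTotalDegree (Fin d) ℝ m).map
    (LinearMap.pi fun x : Pt d => (MvPolynomial.aeval (R := ℝ) (fun j => x j)).toLinearMap)

lemma mem_polyFun {d m : ℕ} {q : Pt d → ℝ} : q ∈ polyFun d m ↔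
    ∃ P : MvPolynomial (Fin d) ℝ, P.totalDegree ≤ m ∧
      ∀ x, q x = MvPolynomial.eval (fun j => x j) P := by
  simp only [polyFun, Submodule.mem_map, MvPolynomial.mem_restrictTotalDegree]
  refine exists_congr fun P => and_congr_right fun _ => ⟨?_, fun h => ?_⟩
  · rintro rfl x
    simp [MvPolynomial.aeval_eq_eval]
  · ext x
    simp [MvPolynomial.aeval_eq_eval, h x]

instance (d m : ℕ) : FiniteDimensional ℝ (polyFun d m) := by
  unfold polyFun
  infer_instance

lemma hasFDerivAt_eval {d : ℕ} (P : MvPolynomial (Fin d) ℝ) (x : Pt d) :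
    HasFDerivAt (fun x : Pt d => MvPolynomial.eval (fun j => x j) P)
      (∑ i, MvPolynomial.eval (fun j => x j) (MvPolynomial.pderiv i P) •
        (EuclideanSpace.proj i : Pt d →L[ℝ] ℝ)) x := by
  induction P using MvPolynomial.induction_on with
  | C a => simpa using hasFDerivAt_const a x
  | add p q hp hq =>
    simp only [map_add, add_smul, Finset.sum_add_distrib]
    exact hp.add hq
  | mul_X p k hp =>
    have hk : HasFDerivAt (fun x : Pt d => x k) (EuclideanSpace.proj k : Pt d →L[ℝ] ℝ) x :=
      (EuclideanSpace.proj k : Pt d →L[ℝ] ℝ).hasFDerivAt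
    simp only [map_mul, MvPolynomial.eval_X]
    refine (hp.mul hk).congr_fderiv ?_
    simp only [MvPolynomial.pderiv_mul, map_add, map_mul, MvPolynomial.eval_X,
      MvPolynomial.pderiv_X, add_smul, Finset.sum_add_distrib]
    rw [add_comm]
    congr 1
    · rw [Finset.smul_sum]
      refine Finset.sum_congr rfl fun i _ => ?_
      rw [smul_smul, mul_comm]
    · rw [Finset.sum_eq_single k]
      · simp
      · intro b _ hb
        simp [Ne.symm hb]
      · simp

lemma contDiff_eval {d : ℕ} (P : MvPolynomial (Fin d) ℝ) :
    ContDiff ℝ 1 (fun x : Pt d => MvPolynomial.eval (fun j => x j) P) := by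
  induction P using MvPolynomial.induction_on with
  | C a => simpa using contDiff_const
  | add p q hp hq => simpa using hp.add hq
  | mul_X p k hp =>
    simp only [map_mul, MvPolynomial.eval_X]
    exact hp.mul (EuclideanSpace.proj k : Pt d →L[ℝ] ℝ).contDiff

lemma contDiff_of_mem_polyFun {d m : ℕ} {q : Pt d → ℝ} (hq : q ∈ polyFun d m) :
    ContDiff ℝ 1 q := by
  obtain ⟨P, -, h⟩ := mem_polyFun.1 hq
  rw [funext h]
  exact contDiff_eval P

lemma totalDegree_pderiv_le {d : ℕ} (i : Fin d) (P : MvPolynomial (Fin d) ℝ) :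
    (MvPolynomial.pderiv i P).totalDegree ≤ P.totalDegree := by
  conv_lhs => rw [P.as_sum, map_sum]
  refine MvPolynomial.totalDegree_finsetSum_le fun s hs => ?_
  rw [MvPolynomial.pderiv_monomial]
  refine (MvPolynomial.totalDegree_monomial_le _ _).trans ?_
  refine le_trans ?_ (MvPolynomial.le_totalDegree hs)
  have h := Finsupp.degree_mono (tsub_le_self : s - Finsupp.single i 1 ≤ s)
  exact h

lemma fderiv_single_mem_polyFun {d m : ℕ} {q : Pt d → ℝ} (hq : q ∈ polyFun d m) (i : Fin d) :
    (fun x => fderiv ℝ q x (EuclideanSpace.single i 1)) ∈ polyFun d m := by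
  obtain ⟨P, hP, h⟩ := mem_polyFun.1 hq
  refine mem_polyFun.2 ⟨MvPolynomial.pderiv i P, (totalDegree_pderiv_le i P).trans hP, fun x => ?_⟩
  rw [funext h, (hasFDerivAt_eval P x).fderiv]
  simp [PiLp.single_apply]

lemma comp_affine_mem_polyFun {d m : ℕ} {q : Pt d → ℝ} (hq : q ∈ polyFun d m) (y : Pt d) (r : ℝ) :
    (fun x => q (y + r • x)) ∈ polyFun d m := by
  obtain ⟨P, hP, h⟩ := mem_polyFun.1 hq
  refine mem_polyFun.2 ⟨MvPolynomial.bind₁ (fun i => MvPolynomial.C (y i) +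
    MvPolynomial.C r * MvPolynomial.X i) P, ?_, fun x => ?_⟩
  · refine le_trans ?_ hP
    conv_lhs => rw [P.as_sum, map_sum]
    refine MvPolynomial.totalDegree_finsetSum_le fun s hs => ?_
    rw [MvPolynomial.bind₁_monomial]
    refine (MvPolynomial.totalDegree_mul _ _).trans ?_
    rw [MvPolynomial.totalDegree_C, zero_add]
    refine (MvPolynomial.totalDegree_finsetProd _ _).trans ?_
    refine le_trans ?_ (MvPolynomial.le_totalDegree hs)
    refine Finset.sum_le_sum fun i _ => (MvPolynomial.totalDegree_pow _ _).trans ?_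
    refine (Nat.mul_le_mul_left _ ?_).trans (mul_one _).le
    refine (MvPolynomial.totalDegree_add _ _).trans (max_le (by simp) ?_)
    refine (MvPolynomial.totalDegree_mul _ _).trans ?_
    simp
  · rw [h]
    refine Eq.trans ?_ (MvPolynomial.eval₂Hom_bind₁ (RingHom.id ℝ) (fun j => x j) _ P).symm
    have h2 : (fun i => MvPolynomial.eval (fun j => x j) (MvPolynomial.C (y i) +
        MvPolynomial.C r * MvPolynomial.X i)) = fun j => (y + r • x) j := by
      ext i
      simp
    exact congrArg (fun g => MvPolynomial.eval g P) h2.symm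

/-- Unique continuation for polynomials. It makes the `L²` seminorm over the unit ball a norm on
`polyFun`. -/
lemma eq_zero_of_mem_polyFun {d m : ℕ} {q : Pt d → ℝ} (hq : q ∈ polyFun d m)
    (h0 : ∀ x ∈ Metric.ball (0 : Pt d) 1, q x = 0) : q = 0 := by
  obtain ⟨P, hP, h⟩ := mem_polyFun.1 hq
  have hP0 : P = 0 := by
    have hd : (0 : ℝ) < 1 / (d + 1) := by positivity
    -- This box lies in the unit ball: each squared coordinate is at most `1 / (d + 1)`, so their
    -- sum is at most `d / (d + 1) < 1`. A polynomial vanishing on a product of infinite sets is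
    -- zero.
    refine MvPolynomial.funext_set (fun _ => Ioo 0 (1 / (d + 1) : ℝ))
      (fun _ => Ioo_infinite hd) fun x hx => ?_
    have hb : WithLp.toLp 2 x ∈ Metric.ball (0 : Pt d) 1 := by
      rw [mem_ball_zero_iff, EuclideanSpace.norm_eq, Real.sqrt_lt' one_pos]
      calc ∑ i, ‖x i‖ ^ 2 ≤ ∑ i : Fin d, (1 / (d + 1) : ℝ) := by
            refine Finset.sum_le_sum fun i _ => ?_
            have hi := hx i (mem_univ i)
            have h1 : (1 / (d + 1) : ℝ) ≤ 1 := by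
              rw [div_le_one (by positivity)]
              linarith [(Nat.cast_nonneg d : (0 : ℝ) ≤ d)]
            rw [Real.norm_eq_abs, sq_abs]
            nlinarith [hi.1, hi.2]
        _ < 1 ^ 2 := by
            simp only [Finset.sum_const, Finset.card_univ, Fintype.card_fin, nsmul_eq_mul, one_pow]
            rw [mul_one_div, div_lt_one (by positivity)]
            linarith
    have := h0 _ hb
    rw [h] at this
    simpa using this
  ext x
  rw [h, hP0]
  simp

/-- On a finite-dimensional space of `C¹` functions, the `C¹` norm on a large ball is controlled by
the `L²` norm on the unit ball. -/
lemma exists_c1_bound {d : ℕ} (W : Submodule ℝ (Pt d → ℝ)) [FiniteDimensional ℝ W]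
    (hW : ∀ q ∈ W, ContDiff ℝ 1 q)
    (hW0 : ∀ q ∈ W, (∀ x ∈ Metric.ball (0 : Pt d) 1, q x = 0) → q = 0) (K : ℝ) :
    ∃ C > 0, ∀ q ∈ W, ∀ x ∈ Metric.closedBall (0 : Pt d) K,
      q x ^ 2 ≤ C * ∫ z in Metric.ball (0 : Pt d) 1, q z ^ 2 ∧
      ‖fderiv ℝ q x‖ ^ 2 ≤ C * ∫ z in Metric.ball (0 : Pt d) 1, q z ^ 2 := by
  set n := Module.finrank ℝ W
  let b := Module.finBasis ℝ W
  set ν := volume.restrict (Metric.ball (0 : Pt d) 1) with hν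
  have : IsFiniteMeasure ν := ⟨by
    rw [hν, Measure.restrict_apply_univ]; exact measure_ball_lt_top⟩
  have hmem : ∀ q ∈ W, MemLp q 2 ν := by
    intro q hq
    obtain ⟨B, hB⟩ := (isCompact_closedBall (0 : Pt d) 1).exists_bound_of_continuousOn
      (hW q hq).continuous.continuousOn
    refine MemLp.of_bound (hW q hq).continuous.aestronglyMeasurable B ?_
    filter_upwards [ae_restrict_mem Metric.isOpen_ball.measurableSet] with x hx
    exact hB x (Metric.ball_subset_closedBall hx)
  -- The synthesis map from coordinates to `L²` classes. Equivalence of norms becomes the statement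
  -- that this map is injective on a finite-dimensional space, hence antilipschitz.
  let L : (Fin n → ℝ) →ₗ[ℝ] Lp ℝ 2 ν :=
    { toFun := fun c => (hmem _ (b.equivFun.symm c).2).toLp
      map_add' := fun c c' => by
        rw [← MemLp.toLp_add]
        congr 1
        rw [map_add]
        rfl
      map_smul' := fun t c => by
        rw [RingHom.id_apply, ← MemLp.toLp_const_smul]
        congr 1
        rw [map_smul]
        rfl }
  have hLnorm : ∀ c, ‖L c‖ ^ 2 = ∫ z in Metric.ball (0 : Pt d) 1, (b.equivFun.symm c : Pt d → ℝ) z ^ 2 := by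
    intro c
    rw [← real_inner_self_eq_norm_sq, L2.inner_def]
    refine integral_congr_ae ?_
    filter_upwards [(hmem _ (b.equivFun.symm c).2).coeFn_toLp] with x hx
    change inner ℝ (((hmem _ (b.equivFun.symm c).2).toLp : Pt d → ℝ) x)
      (((hmem _ (b.equivFun.symm c).2).toLp : Pt d → ℝ) x) = _
    rw [hx]
    simp [sq]
  have hker : LinearMap.ker L = ⊥ := by
    rw [LinearMap.ker_eq_bot']
    intro c hc
    set q := b.equivFun.symm c with hq
    have h1 : (q : Pt d → ℝ) =ᵐ[ν] 0 := by
      have h2 := (hmem _ q.2).coeFn_toLp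
      have h3 : (hmem _ q.2).toLp = 0 := hc
      rw [h3] at h2
      exact h2.symm.trans (Lp.coeFn_zero ℝ 2 ν)
    have h4 : EqOn (q : Pt d → ℝ) 0 (Metric.ball 0 1) :=
      Measure.eqOn_open_of_ae_eq h1 Metric.isOpen_ball (hW _ q.2).continuous.continuousOn
        continuousOn_const
    have h5 : q = 0 := Subtype.ext (hW0 _ q.2 h4)
    exact b.equivFun.symm.map_eq_zero_iff.1 h5
  obtain ⟨A, hA0, hA⟩ := L.exists_antilipschitzWith hker
  have hbd : ∀ i, ∃ S, ∀ x ∈ Metric.closedBall (0 : Pt d) K,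
      ‖(b i : Pt d → ℝ) x‖ ≤ S ∧ ‖fderiv ℝ (b i : Pt d → ℝ) x‖ ≤ S := by
    intro i
    obtain ⟨S1, h1⟩ := (isCompact_closedBall (0 : Pt d) K).exists_bound_of_continuousOn
      (hW _ (b i).2).continuous.continuousOn
    obtain ⟨S2, h2⟩ := (isCompact_closedBall (0 : Pt d) K).exists_bound_of_continuousOn
      ((hW _ (b i).2).continuous_fderiv one_ne_zero).continuousOn
    exact ⟨max S1 S2, fun x hx => ⟨(h1 x hx).trans (le_max_left _ _),
      (h2 x hx).trans (le_max_right _ _)⟩⟩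
  choose S hS using hbd
  set T := ∑ i, |S i|
  -- The summand `1` only keeps the constant positive when `A * T = 0`.
  refine ⟨(A * T) ^ 2 + 1, by positivity, fun q hq x hx => ?_⟩
  set c := b.equivFun ⟨q, hq⟩ with hc
  have hqc : b.equivFun.symm c = ⟨q, hq⟩ := by simp [hc]
  have hI : ∫ z in Metric.ball (0 : Pt d) 1, q z ^ 2 = ‖L c‖ ^ 2 := by rw [hLnorm, hqc]
  have hcL : ‖c‖ ≤ A * ‖L c‖ := by
    have := hA.le_mul_dist c 0
    simpa using this
  have hsum : q = ∑ i, c i • (b i : Pt d → ℝ) := by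
    have := congrArg (Subtype.val) hqc
    rw [b.equivFun_symm_apply] at this
    simpa using this.symm
  have key : ∀ {v : ℝ} , v ≤ ∑ i, |c i| * |S i| → 0 ≤ v → v ^ 2 ≤ ((A * T) ^ 2 + 1) * ‖L c‖ ^ 2 := by
    intro v hv hv0
    have h1 : v ≤ (A * T) * ‖L c‖ := by
      calc v ≤ ∑ i, |c i| * |S i| := hv
        _ ≤ ∑ i, ‖c‖ * |S i| := Finset.sum_le_sum fun i _ =>
            mul_le_mul_of_nonneg_right (norm_le_pi_norm c i) (abs_nonneg _)
        _ = ‖c‖ * T := by rw [Finset.mul_sum]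
        _ ≤ (A * ‖L c‖) * T := mul_le_mul_of_nonneg_right hcL
            (Finset.sum_nonneg fun _ _ => abs_nonneg _)
        _ = _ := by ring
    calc v ^ 2 ≤ ((A * T) * ‖L c‖) ^ 2 := pow_le_pow_left₀ hv0 h1 2
      _ ≤ _ := by nlinarith [sq_nonneg ‖L c‖]
  rw [hI]
  constructor
  · rw [← sq_abs]
    refine key ?_ (abs_nonneg _)
    rw [hsum, Finset.sum_apply]
    refine (Finset.abs_sum_le_sum_abs _ _).trans (Finset.sum_le_sum fun i _ => ?_)
    rw [Pi.smul_apply, smul_eq_mul, abs_mul]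
    exact mul_le_mul_of_nonneg_left (((hS i x hx).1).trans (le_abs_self _)) (abs_nonneg _)
  · refine key ?_ (norm_nonneg _)
    have hd : ∀ i, DifferentiableAt ℝ (b i : Pt d → ℝ) x := fun i =>
      (hW _ (b i).2).differentiable one_ne_zero x
    rw [hsum, fderiv_sum fun i _ => (hd i).const_smul (c i)]
    refine (norm_sum_le _ _).trans (Finset.sum_le_sum fun i _ => ?_)
    rw [fderiv_const_smul (hd i), norm_smul]
    exact mul_le_mul_of_nonneg_left (((hS i x hx).2).trans (le_abs_self _)) (abs_nonneg _)

lemma setIntegral_ball_rescale {d : ℕ} (f : Pt d → ℝ) (y : Pt d) {r : ℝ} (hr : 0 < r) :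
    ∫ z in Metric.ball (0 : Pt d) 1, f (y + r • z) = (r ^ d)⁻¹ * ∫ z in Metric.ball y r, f z := by
  have h1 := Measure.setIntegral_comp_smul_of_pos volume (fun z => f (y + z))
    (Metric.ball (0 : Pt d) 1) hr
  simp only [finrank_euclideanSpace, Fintype.card_fin, smul_eq_mul] at h1
  rw [h1, smul_unitBall_of_pos hr]
  congr 1
  have h2 := (measurePreserving_add_left (volume : Measure (Pt d)) y).setIntegral_preimage_emb
    (measurableEmbedding_addLeft y) f (Metric.ball y r)
  rw [← h2]
  congr 2
  ext z
  simp

/-- Sup norm and gradient bounds for polynomials: inverse estimates on balls. -/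
lemma exists_poly_bound (d m : ℕ) (K : ℝ) :
    ∃ C > 0, ∀ q ∈ polyFun d m, ∀ (y : Pt d) (r : ℝ), 0 < r → ∀ x ∈ Metric.closedBall y (K * r),
      q x ^ 2 ≤ C / r ^ d * ∫ z in Metric.ball y r, q z ^ 2 ∧
      ‖fderiv ℝ q x‖ ^ 2 ≤ C / r ^ (d + 2) * ∫ z in Metric.ball y r, q z ^ 2 := by
  obtain ⟨C, hC, h⟩ := exists_c1_bound (polyFun d m) (fun q hq => contDiff_of_mem_polyFun hq)
    (fun q hq => eq_zero_of_mem_polyFun hq) K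
  refine ⟨C, hC, fun q hq y r hr x hx => ?_⟩
  have hx' : r⁻¹ • (x - y) ∈ Metric.closedBall (0 : Pt d) K := by
    rw [mem_closedBall_zero_iff, norm_smul, norm_inv, Real.norm_of_nonneg hr.le,
      inv_mul_le_iff₀ hr, mul_comm, ← dist_eq_norm]
    exact hx
  have hxx : y + r • r⁻¹ • (x - y) = x := by
    rw [smul_smul, mul_inv_cancel₀ hr.ne', one_smul, add_sub_cancel]
  obtain ⟨h1, h2⟩ := h _ (comp_affine_mem_polyFun hq y r) _ hx'
  rw [setIntegral_ball_rescale (fun z => q z ^ 2) y hr] at h1 h2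
  simp only [hxx] at h1
  refine ⟨h1.trans_eq (by ring), ?_⟩
  -- The chain rule factor `r`, squared, turns the scaling `r ^ d` of the integral into `r ^ (d +
  -- 2)`.
  have hf : fderiv ℝ (fun x => q (y + r • x)) (r⁻¹ • (x - y)) = r • fderiv ℝ q x := by
    have hq' : HasFDerivAt q (fderiv ℝ q x) (y + r • r⁻¹ • (x - y)) := by
      rw [hxx]
      exact ((contDiff_of_mem_polyFun hq).differentiable one_ne_zero x).hasFDerivAt
    have h3 : HasFDerivAt (fun x : Pt d => y + r • x) (r • ContinuousLinearMap.id ℝ (Pt d))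
        (r⁻¹ • (x - y)) := ((hasFDerivAt_id _).const_smul r).const_add y
    have := (HasFDerivAt.comp (r⁻¹ • (x - y)) (f := fun x : Pt d => y + r • x) hq' h3).fderiv
    rw [Function.comp_def] at this
    rw [this]
    ext v
    simp
  rw [hf, norm_smul, Real.norm_of_nonneg hr.le, mul_pow] at h2
  rw [← mul_le_mul_iff_right₀ (pow_pos hr 2)]
  refine h2.trans_eq ?_
  field_simp
  ring

/-! ### Symmetric gradients of polynomial maps -/

lemma IsPolyMap.coord_mem {d m : ℕ} {p : Pt d → Pt d} (hp : IsPolyMap m p) (i : Fin d) :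
    (fun x => p x i) ∈ polyFun d m := by
  obtain ⟨P, hP, h⟩ := hp
  exact mem_polyFun.2 ⟨P i, hP i, fun x => h x i⟩

lemma IsPolyMap.contDiff {d m : ℕ} {p : Pt d → Pt d} (hp : IsPolyMap m p) : ContDiff ℝ 1 p :=
  contDiff_euclidean.2 fun i => contDiff_of_mem_polyFun (hp.coord_mem i)

lemma IsPolyMap.differentiable {d m : ℕ} {p : Pt d → Pt d} (hp : IsPolyMap m p) :
    Differentiable ℝ p := hp.contDiff.differentiable one_ne_zero

lemma IsPolyMap.sub {d m : ℕ} {p q : Pt d → Pt d} (hp : IsPolyMap m p) (hq : IsPolyMap m q) :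
    IsPolyMap m (p - q) := by
  obtain ⟨P, hP, h⟩ := hp
  obtain ⟨Q, hQ, h'⟩ := hq
  exact ⟨P - Q, fun i => (MvPolynomial.totalDegree_sub _ _).trans (max_le (hP i) (hQ i)),
    fun x i => by simp [h, h']⟩

lemma fderiv_coord {d : ℕ} {p : Pt d → Pt d} {x : Pt d} (hp : DifferentiableAt ℝ p x) (i : Fin d)
    (v : Pt d) : fderiv ℝ p x v i = fderiv ℝ (fun y => p y i) x v := by
  have := ((EuclideanSpace.proj i : Pt d →L[ℝ] ℝ).hasFDerivAt.comp x hp.hasFDerivAt).fderiv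
  have h2 : (fun y => p y i) = (EuclideanSpace.proj i : Pt d →L[ℝ] ℝ) ∘ p := rfl
  rw [h2, this]
  rfl

lemma symGrad_sub {d : ℕ} {p q : Pt d → Pt d} {x : Pt d} (hp : DifferentiableAt ℝ p x)
    (hq : DifferentiableAt ℝ q x) (i j : Fin d) :
    symGrad (p - q) x i j = symGrad p x i j - symGrad q x i j := by
  simp only [symGrad, fderiv_sub hp hq, sub_apply, PiLp.sub_apply]
  ring

lemma IsPolyMap.symGrad_mem {d m : ℕ} {p : Pt d → Pt d} (hp : IsPolyMap m p) (i j : Fin d) :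
    (fun x => symGrad p x i j) ∈ polyFun d m := by
  have h : (fun x => symGrad p x i j) =
      (2⁻¹ : ℝ) • ((fun x => fderiv ℝ (fun y => p y i) x (EuclideanSpace.single j 1)) +
        (fun x => fderiv ℝ (fun y => p y j) x (EuclideanSpace.single i 1))) := by
    ext x
    simp only [symGrad, Pi.smul_apply, Pi.add_apply, smul_eq_mul,
      fderiv_coord (hp.differentiable x)]
    ring
  rw [h]
  exact Submodule.smul_mem _ _ (Submodule.add_mem _ (fderiv_single_mem_polyFun (hp.coord_mem i) j)
    (fderiv_single_mem_polyFun (hp.coord_mem j) i))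

lemma IsPolyMap.continuous_symGrad {d m : ℕ} {p : Pt d → Pt d} (hp : IsPolyMap m p) (i j : Fin d) :
    Continuous fun x => symGrad p x i j :=
  (contDiff_of_mem_polyFun (hp.symGrad_mem i j)).continuous

lemma sq_symGrad_le_frob {d : ℕ} (A : Matrix (Fin d) (Fin d) ℝ) (i j : Fin d) :
    A i j ^ 2 ≤ frob A A := by
  unfold frob
  calc A i j ^ 2 = A i j * A i j := sq _
    _ ≤ ∑ j', A i j' * A i j' :=
        Finset.single_le_sum (f := fun j' => A i j' * A i j') (fun _ _ => mul_self_nonneg _)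
          (Finset.mem_univ j)
    _ ≤ _ := Finset.single_le_sum (f := fun i' => ∑ j', A i' j' * A i' j')
          (fun _ _ => Finset.sum_nonneg fun _ _ => mul_self_nonneg _) (Finset.mem_univ i)

lemma frob_self_nonneg {d : ℕ} (A : Matrix (Fin d) (Fin d) ℝ) : 0 ≤ frob A A :=
  Finset.sum_nonneg fun _ _ => Finset.sum_nonneg fun _ _ => mul_self_nonneg _

lemma frob_self_le {d : ℕ} {A : Matrix (Fin d) (Fin d) ℝ} {b : ℝ} (h : ∀ i j, A i j ^ 2 ≤ b) :
    frob A A ≤ d ^ 2 * b := by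
  unfold frob
  calc _ ≤ ∑ i : Fin d, ∑ j : Fin d, b :=
        Finset.sum_le_sum fun i _ => Finset.sum_le_sum fun j _ => by
          rw [← sq]; exact h i j
    _ = _ := by simp; ring

lemma IsPolyMap.continuous_frob {d m : ℕ} {p : Pt d → Pt d} (hp : IsPolyMap m p) :
    Continuous fun x => frob (symGrad p x) (symGrad p x) :=
  continuous_finsetSum _ fun i _ => continuous_finsetSum _ fun j _ =>
    (hp.continuous_symGrad i j).mul (hp.continuous_symGrad i j)

lemma integrableOn_of_continuous {d : ℕ} {E : Type*} [NormedAddCommGroup E] {f : Pt d → E}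
    (hf : Continuous f) {s : Set (Pt d)} (hs : Bornology.IsBounded s) : IntegrableOn f s :=
  (hf.continuousOn.integrableOn_compact hs.isCompact_closure).mono_set subset_closure

/-- Inverse estimate for the symmetric gradient. -/
lemma exists_symGrad_bound (d m : ℕ) (K : ℝ) :
    ∃ C > 0, ∀ p : Pt d → Pt d, IsPolyMap m p → ∀ (y : Pt d) (r : ℝ), 0 < r →
      ∀ x ∈ Metric.closedBall y (K * r), ∀ i j,
      symGrad p x i j ^ 2 ≤
        C / r ^ d * ∫ z in Metric.ball y r, frob (symGrad p z) (symGrad p z) := by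
  obtain ⟨C, hC, h⟩ := exists_poly_bound d m K
  refine ⟨C, hC, fun p hp y r hr x hx i j => ?_⟩
  refine ((h _ (hp.symGrad_mem i j) y r hr x hx).1).trans ?_
  refine mul_le_mul_of_nonneg_left ?_ (by positivity)
  exact integral_mono (integrableOn_of_continuous ((hp.continuous_symGrad i j).pow 2)
    Metric.isBounded_ball) (integrableOn_of_continuous hp.continuous_frob
    Metric.isBounded_ball) fun z => sq_symGrad_le_frob _ i j

/-- Inverse estimate for the symmetric gradient against the `L²` norm of the map. -/
lemma exists_symGrad_bound_norm (d m : ℕ) (K : ℝ) :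
    ∃ C > 0, ∀ p : Pt d → Pt d, IsPolyMap m p → ∀ (y : Pt d) (r : ℝ), 0 < r →
      ∀ x ∈ Metric.closedBall y (K * r), ∀ i j,
      symGrad p x i j ^ 2 ≤ C / r ^ (d + 2) * ∫ z in Metric.ball y r, ‖p z‖ ^ 2 := by
  obtain ⟨C, hC, h⟩ := exists_poly_bound d m K
  refine ⟨C, hC, fun p hp y r hr x hx i j => ?_⟩
  have key : ∀ i j, (fderiv ℝ p x (EuclideanSpace.single j 1) i) ^ 2 ≤
      C / r ^ (d + 2) * ∫ z in Metric.ball y r, ‖p z‖ ^ 2 := by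
    intro i j
    rw [fderiv_coord (hp.differentiable x)]
    have h1 := (h _ (hp.coord_mem i) y r hr x hx).2
    have h2 : (fderiv ℝ (fun y => p y i) x (EuclideanSpace.single j 1)) ^ 2 ≤
        ‖fderiv ℝ (fun y => p y i) x‖ ^ 2 := by
      rw [← sq_abs, ← Real.norm_eq_abs]
      refine pow_le_pow_left₀ (norm_nonneg _) ?_ 2
      simpa using (fderiv ℝ (fun y => p y i) x).le_opNorm (EuclideanSpace.single j (1 : ℝ))
    refine (h2.trans h1).trans (mul_le_mul_of_nonneg_left ?_ (by positivity))
    have hc : Continuous p := hp.contDiff.continuous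
    refine integral_mono (integrableOn_of_continuous
      ((contDiff_of_mem_polyFun (hp.coord_mem i)).continuous.pow 2) Metric.isBounded_ball)
      (integrableOn_of_continuous (hc.norm.pow 2) Metric.isBounded_ball) fun z => ?_
    change (p z i) ^ 2 ≤ ‖p z‖ ^ 2
    rw [← sq_abs, ← Real.norm_eq_abs]
    exact pow_le_pow_left₀ (norm_nonneg _) (PiLp.norm_apply_le (p z) i) 2
  have h1 := key i j
  have h2 := key j i
  simp only [symGrad]
  nlinarith [sq_nonneg (fderiv ℝ p x (EuclideanSpace.single j 1) i -
    fderiv ℝ p x (EuclideanSpace.single i 1) j)]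

/-! ### Geometry of a regular level set -/

/-- Uniform interior cone condition for `ω` at `x`, in convex form. -/
def HasConeAt {d : ℕ} (r₀ : ℝ) (ω : Set (Pt d)) (x : Pt d) : Prop :=
  ∀ r, 0 < r → r ≤ r₀ → ∃ K y, IsOpen K ∧ Convex ℝ K ∧ K ⊆ ω ∧ x ∈ closure K ∧
    K ⊆ Metric.ball x (2 * r) ∧ Metric.ball y (r / 4) ⊆ K

/-- Uniform continuity of the derivative on the compact 1-thickening of `S`, followed by the mean
value inequality on a convex ball with the derivative at the centre `x` subtracted. The radius is
capped at 1 so that the ball stays in the thickening. -/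
lemma exists_uniform_linearization {d : ℕ} {φ : Pt d → ℝ} (hφ : ContDiff ℝ 1 φ) {S : Set (Pt d)}
    (hS : IsCompact S) {ε : ℝ} (hε : 0 < ε) :
    ∃ r > 0, ∀ x ∈ S, ∀ y ∈ Metric.closedBall x r, ∀ z ∈ Metric.closedBall x r,
      |φ y - φ z - inner ℝ (gradient φ x) (y - z)| ≤ ε * ‖y - z‖ := by
  have hT : IsCompact (Metric.cthickening 1 S) := hS.cthickening
  have hu := hT.uniformContinuousOn_of_continuous (hφ.continuous_fderiv one_ne_zero).continuousOn
  obtain ⟨r, hr, h⟩ := Metric.uniformContinuousOn_iff_le.1 hu ε hε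
  refine ⟨min r 1, by positivity, fun x hx y hy z hz => ?_⟩
  have hsub : ∀ v ∈ Metric.closedBall x (min r 1), v ∈ Metric.cthickening 1 S := fun v hv =>
    Metric.mem_cthickening_of_dist_le _ _ _ _ hx (hv.trans (min_le_right _ _))
  have hxb : x ∈ Metric.closedBall x (min r 1) := Metric.mem_closedBall_self (by positivity)
  have hd : DifferentiableAt ℝ φ x := hφ.differentiable one_ne_zero x
  have hg : ∀ v, inner ℝ (gradient φ x) v = fderiv ℝ φ x v := fun v => by
    rw [gradient, InnerProductSpace.toDual_symm_apply]
  rw [hg, ← Real.norm_eq_abs]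
  refine (convex_closedBall x (min r 1)).norm_image_sub_le_of_norm_hasFDerivWithin_le'
    (f' := fderiv ℝ φ)
    (fun v _ => (hφ.differentiable one_ne_zero v).hasFDerivAt.hasFDerivWithinAt)
    (fun v hv => ?_) hz hy
  rw [← dist_eq_norm]
  exact h v (hsub v hv) x (hsub x hxb) (hv.trans (min_le_left _ _))

lemma exists_gradient_lower_bound {d : ℕ} {φ : Pt d → ℝ} (hφ : ContDiff ℝ 1 φ) {S : Set (Pt d)}
    (hS : IsCompact S) (h0 : ∀ x ∈ S, gradient φ x ≠ 0) :
    ∃ m > 0, ∀ x ∈ S, m ≤ ‖gradient φ x‖ := by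
  rcases S.eq_empty_or_nonempty with rfl | hne
  · exact ⟨1, one_pos, by simp⟩
  have hc : Continuous (gradient φ) :=
    (InnerProductSpace.toDual ℝ (Pt d)).symm.continuous.comp (hφ.continuous_fderiv one_ne_zero)
  obtain ⟨x, hx, hmin⟩ := hS.exists_isMinOn hne hc.norm.continuousOn
  exact ⟨‖gradient φ x‖, norm_pos_iff.2 (h0 x hx), fun y hy => hmin hy⟩

lemma exists_cone {d : ℕ} {φ : Pt d → ℝ} (hφ : ContDiff ℝ 1 φ) {S : Set (Pt d)}
    (hS : IsCompact S) (h0 : ∀ x ∈ S, gradient φ x ≠ 0) (hz : ∀ x ∈ S, φ x = 0) :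
    ∃ r₀ > 0, ∀ x ∈ S, HasConeAt r₀ {y | φ y < 0} x := by
  obtain ⟨m, hm, hmin⟩ := exists_gradient_lower_bound hφ hS h0
  obtain ⟨ρ, hρ, hlin⟩ := exists_uniform_linearization hφ hS (ε := m / 4) (by positivity)
  refine ⟨ρ / 2, by positivity, fun x hx r hr hr0 => ?_⟩
  set G := gradient φ x with hG
  have hGpos : 0 < ‖G‖ := hm.trans_le (hmin x hx)
  set n := ‖G‖⁻¹ • G with hn
  have hn1 : ‖n‖ = 1 := by
    rw [hn, norm_smul, norm_inv, norm_norm, inv_mul_cancel₀ hGpos.ne']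
  have hGn : inner ℝ G n = ‖G‖ := by
    rw [hn, inner_smul_right, real_inner_self_eq_norm_sq]
    field_simp
  have hdist : ∀ t z, z ∈ Metric.ball (x - t • n) (t / 2) → 0 < t → dist z x < 3 / 2 * t := by
    intro t z hzt ht
    calc dist z x ≤ dist z (x - t • n) + dist (x - t • n) x := dist_triangle _ _ _
      _ < t / 2 + t := by
          refine add_lt_add_of_lt_of_le hzt ?_
          rw [dist_eq_norm]
          simp [norm_smul, hn1, abs_of_pos ht]
      _ = _ := by ring
  -- A truncated open cone with apex `x` and axis `-n`, swept by balls whose centre and radius are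
  -- affine in `t`; this makes it convex. The ball of radius `r / 4` is the one at `t = r / 2`.
  refine ⟨⋃ t ∈ Ioo 0 r, Metric.ball (x - t • n) (t / 2), x - (r / 2) • n,
    isOpen_biUnion fun _ _ => Metric.isOpen_ball, ?_, ?_, ?_, ?_, ?_⟩
  · intro z hz z' hz' a b ha hb hab
    simp only [mem_iUnion, exists_prop] at hz hz' ⊢
    obtain ⟨t, ht, hz⟩ := hz
    obtain ⟨t', ht', hz'⟩ := hz'
    refine ⟨a * t + b * t', (convex_Ioo 0 r) ht ht' ha hb hab, ?_⟩
    rw [Metric.mem_ball, dist_eq_norm] at hz hz' ⊢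
    have heq : a • z + b • z' - (x - (a * t + b * t') • n) =
        a • (z - (x - t • n)) + b • (z' - (x - t' • n)) := by
      have : x = a • x + b • x := by rw [← add_smul, hab, one_smul]
      conv_lhs => rw [this]
      module
    rw [heq]
    have h1 := norm_add_le (a • (z - (x - t • n))) (b • (z' - (x - t' • n)))
    rw [norm_smul, norm_smul, Real.norm_of_nonneg ha, Real.norm_of_nonneg hb] at h1
    rcases ha.eq_or_lt with rfl | ha
    · have : b = 1 := by linarith
      subst this
      linarith
    · nlinarith
  · refine iUnion₂_subset fun t ht z hzt => ?_
    have hzx := hdist t z hzt ht.1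
    have h1 := hlin x hx z (hzx.le.trans (by linarith [ht.2])) x
      (Metric.mem_closedBall_self hρ.le)
    rw [hz x hx, sub_zero, ← hG] at h1
    have h2 := (abs_le.1 h1).2
    rw [← dist_eq_norm] at h2
    -- On the ball with parameter `t` the linear part is at most `-t‖G‖/2 ≤ -tm/2`, while the
    -- linearization error is at most `(m/4)(3t/2) = 3tm/8`. The sign is therefore strict.
    have h3 : inner ℝ G (z - x) = inner ℝ G (z - (x - t • n)) - t * ‖G‖ := by
      rw [show z - x = (z - (x - t • n)) - t • n by module, inner_sub_right, inner_smul_right, hGn]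
    have h4 := real_inner_le_norm G (z - (x - t • n))
    rw [Metric.mem_ball, dist_eq_norm] at hzt
    have h5 := hmin x hx
    have ht0 := ht.1
    change φ z < 0
    have h6 : ‖G‖ * ‖z - (x - t • n)‖ ≤ ‖G‖ * (t / 2) := mul_le_mul_of_nonneg_left hzt.le hGpos.le
    have h7 : m * t ≤ ‖G‖ * t := mul_le_mul_of_nonneg_right h5 ht0.le
    have h8 : m / 4 * dist z x ≤ m / 4 * (3 / 2 * t) := mul_le_mul_of_nonneg_left hzx.le (by positivity)
    have h9 : 0 < m * t := by positivity
    linarith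
  · rw [Metric.mem_closure_iff]
    intro ε hε
    set t := min (ε / 2) (r / 2) with ht
    have ht0 : 0 < t := by positivity
    have htε : t ≤ ε / 2 := min_le_left _ _
    have htr : t ≤ r / 2 := min_le_right _ _
    refine ⟨x - t • n, mem_iUnion₂.2 ⟨t, ⟨ht0, by linarith⟩, Metric.mem_ball_self (by positivity)⟩, ?_⟩
    rw [dist_eq_norm]
    simp only [sub_sub_cancel, norm_smul, hn1, Real.norm_of_nonneg ht0.le]
    linarith
  · refine iUnion₂_subset fun t ht z hzt => ?_
    exact (hdist t z hzt ht.1).trans (by linarith [ht.1, ht.2])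
  · refine fun z hz => mem_iUnion₂.2 ⟨r / 2, ⟨by positivity, by linarith⟩, ?_⟩
    convert hz using 2
    ring

/-- The orthogonal projection along a unit vector, with values in `ℝ^(d-1)`. -/
lemma exists_projection {d : ℕ} {n : Pt d} (hn : ‖n‖ = 1) :
    ∃ L : Pt d →ₗ[ℝ] Pt (d - 1), ∀ v, ‖L v‖ ^ 2 = ‖v‖ ^ 2 - inner ℝ n v ^ 2 := by
  set H := (ℝ ∙ n)ᗮ with hH
  have hn0 : n ≠ 0 := by
    rintro rfl
    simp at hn
  have hd : Module.finrank ℝ H = d - 1 := by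
    have h1 := Submodule.finrank_add_finrank_orthogonal (ℝ ∙ n)
    rw [finrank_span_singleton hn0, finrank_euclideanSpace_fin, ← hH] at h1
    omega
  let e := (stdOrthonormalBasis ℝ H).repr
  rw [hd] at e
  refine ⟨e.toLinearEquiv.toLinearMap ∘ₗ (H.orthogonalProjectionOnto : Pt d →L[ℝ] H).toLinearMap, fun v => ?_⟩
  have h1 : ‖(e.toLinearEquiv.toLinearMap ∘ₗ
      (H.orthogonalProjectionOnto : Pt d →L[ℝ] H).toLinearMap) v‖ = ‖H.orthogonalProjectionOnto v‖ :=
    e.norm_map _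
  rw [h1]
  have h2 := Submodule.norm_sq_eq_add_norm_sq_projection v (ℝ ∙ n)
  have h3 : ‖(ℝ ∙ n).orthogonalProjectionOnto v‖ ^ 2 = inner ℝ n v ^ 2 := by
    rw [← Submodule.norm_coe, Submodule.coe_orthogonalProjectionOnto_apply,
      Submodule.starProjection_unit_singleton ℝ hn, norm_smul, hn, mul_one, Real.norm_eq_abs, sq_abs]
  linarith

lemma euclideanHausdorffMeasure_image_le {X Y : Type*} [EMetricSpace X] [EMetricSpace Y]
    [MeasurableSpace X] [BorelSpace X] [MeasurableSpace Y] [BorelSpace Y] {f : X → Y} {s : Set X}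
    {K : NNReal} (hf : LipschitzOnWith K f s) (k : ℕ) :
    μHE[k] (f '' s) ≤ (K : ENNReal) ^ k * μHE[k] s := by
  have h := hf.hausdorffMeasure_image_le (d := k) (by positivity)
  rw [ENNReal.rpow_natCast] at h
  simp only [Measure.euclideanHausdorffMeasure_def, Measure.smul_apply, ENNReal.smul_def,
    smul_eq_mul]
  calc _ ≤ _ := mul_le_mul_right h _
    _ = _ := by ring

lemma euclideanHausdorffMeasure_closedBall_le (k : ℕ) :
    ∃ c : ℝ, 0 < c ∧ ∀ (y : Pt k) (r : ℝ), 0 ≤ r →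
      μHE[k] (Metric.closedBall y r) ≤ ENNReal.ofReal (c * r ^ k) := by
  have : (μHE[k] : Measure (Pt k)).IsAddHaarMeasure := by
    have h := isAddHaarMeasure_euclideanHausdorffMeasure (E := Pt k)
    rwa [finrank_euclideanSpace_fin] at h
  have hfin : (μHE[k] : Measure (Pt k)) (Metric.closedBall 0 1) ≠ ⊤ :=
    (isCompact_closedBall _ _).measure_ne_top
  refine ⟨((μHE[k] : Measure (Pt k)) (Metric.closedBall 0 1)).toReal + 1, by positivity,
    fun y r hr => ?_⟩
  rw [Measure.addHaar_closedBall' _ _ hr, finrank_euclideanSpace_fin,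
    ← ENNReal.ofReal_toReal hfin, ← ENNReal.ofReal_mul (by positivity)]
  refine ENNReal.ofReal_le_ofReal ?_
  rw [ENNReal.toReal_ofReal (by positivity), mul_comm]
  gcongr
  linarith

/-- Ahlfors upper regularity of a compact regular level set. -/
lemma exists_interface_measure_bound {d : ℕ} {φ : Pt d → ℝ} (hφ : ContDiff ℝ 1 φ) {S : Set (Pt d)}
    (hS : IsCompact S) (h0 : ∀ x ∈ S, gradient φ x ≠ 0) (hz : ∀ x ∈ S, φ x = 0) :
    ∃ A > 0, ∀ y r, 0 ≤ r → μHE[d - 1] (S ∩ Metric.closedBall y r) ≤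
      ENNReal.ofReal (A * r ^ (d - 1)) := by
  obtain ⟨m, hm, hmin⟩ := exists_gradient_lower_bound hφ hS h0
  obtain ⟨ρ, hρ, hlin⟩ := exists_uniform_linearization hφ hS (ε := m / 4) (by positivity)
  obtain ⟨c, hc, hcb⟩ := euclideanHausdorffMeasure_closedBall_le (d - 1)
  have hloc : ∀ x ∈ S, ∀ y r, 0 ≤ r →
      μHE[d - 1] (S ∩ Metric.closedBall x ρ ∩ Metric.closedBall y r) ≤
        ENNReal.ofReal (2 ^ (d - 1) * (c * r ^ (d - 1))) := by
    intro x hx y r hr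
    set G := gradient φ x with hG
    have hGpos : 0 < ‖G‖ := hm.trans_le (hmin x hx)
    set n := ‖G‖⁻¹ • G with hn
    have hn1 : ‖n‖ = 1 := by
      rw [hn, norm_smul, norm_inv, norm_norm, inv_mul_cancel₀ hGpos.ne']
    obtain ⟨L, hL⟩ := exists_projection hn1
    set B := S ∩ Metric.closedBall x ρ ∩ Metric.closedBall y r with hB
    -- Nearby points of the level set differ almost tangentially: since `φ a = φ b = 0`, the
    -- linearization bounds the normal part of `a - b` by a quarter of its length. The projection
    -- thus keeps at least 15/16 of the squared length.
    have hanti : ∀ a ∈ B, ∀ b ∈ B, dist a b ≤ 2 * dist (L a) (L b) := by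
      intro a ha b hb
      have h1 := hlin x hx a ha.1.2 b hb.1.2
      rw [hz a ha.1.1, hz b hb.1.1, sub_zero, zero_sub, abs_neg, ← hG] at h1
      have h2 : |inner ℝ n (a - b)| ≤ 1 / 4 * ‖a - b‖ := by
        rw [hn, real_inner_smul_left, abs_mul, abs_of_pos (inv_pos.2 hGpos), inv_mul_le_iff₀ hGpos]
        refine h1.trans ?_
        have := mul_le_mul_of_nonneg_right (hmin x hx) (norm_nonneg (a - b))
        linarith
      have h3 := hL (a - b)
      rw [map_sub, ← sq_abs (inner ℝ n (a - b))] at h3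
      rw [dist_eq_norm, dist_eq_norm]
      refine abs_le_of_sq_le_sq' ?_ (by positivity) |>.2
      have h4 := pow_le_pow_left₀ (abs_nonneg _) h2 2
      nlinarith [sq_nonneg ‖a - b‖]
    have hinj : InjOn L B := fun a ha b hb hab => by
      have := hanti a ha b hb
      rw [hab, dist_self, mul_zero] at this
      exact dist_le_zero.1 this
    -- The piece of surface is a 2-Lipschitz image of a subset of a flat ball of radius `r`, which
    -- bounds its Hausdorff measure.
    have hLip : LipschitzOnWith 2 (Function.invFunOn L B) (L '' B) := by
      refine LipschitzOnWith.of_dist_le_mul ?_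
      rintro _ ⟨a, ha, rfl⟩ _ ⟨b, hb, rfl⟩
      rw [hinj.leftInvOn_invFunOn ha, hinj.leftInvOn_invFunOn hb]
      exact hanti a ha b hb
    have himg : Function.invFunOn L B '' (L '' B) = B := hinj.invFunOn_image Subset.rfl
    have hsub : L '' B ⊆ Metric.closedBall (L y) r := by
      rintro _ ⟨a, ha, rfl⟩
      rw [mem_closedBall_iff_norm, ← map_sub]
      have h1 : ‖a - y‖ ≤ r := mem_closedBall_iff_norm.1 ha.2
      refine le_trans ?_ h1
      refine abs_le_of_sq_le_sq' ?_ (norm_nonneg _) |>.2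
      rw [hL]
      linarith [sq_nonneg (inner ℝ n (a - y))]
    calc μHE[d - 1] B = μHE[d - 1] (Function.invFunOn L B '' (L '' B)) := by rw [himg]
      _ ≤ ((2 : NNReal) : ENNReal) ^ (d - 1) * μHE[d - 1] (L '' B) :=
          euclideanHausdorffMeasure_image_le hLip _
      _ ≤ ((2 : NNReal) : ENNReal) ^ (d - 1) * ENNReal.ofReal (c * r ^ (d - 1)) := by
          gcongr
          exact (measure_mono hsub).trans (hcb _ _ hr)
      _ = _ := by
          rw [ENNReal.ofReal_mul (p := 2 ^ (d - 1)) (by positivity),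
            ENNReal.ofReal_pow (by positivity)]
          norm_num
  obtain ⟨t, ht, hcov⟩ := hS.elim_nhds_subcover (fun x => Metric.closedBall x ρ)
    fun x _ => Metric.closedBall_mem_nhds x hρ
  -- Compactness reduces the bound to finitely many local graphs; `+ 1` keeps the constant positive
  -- for an empty cover.
  refine ⟨(t.card + 1) * (2 ^ (d - 1) * c), by positivity, fun y r hr => ?_⟩
  have hsub : S ∩ Metric.closedBall y r ⊆
      ⋃ x ∈ t, S ∩ Metric.closedBall x ρ ∩ Metric.closedBall y r := by
    rintro a ⟨ha, hay⟩
    obtain ⟨x, hx, hax⟩ := mem_iUnion₂.1 (hcov ha)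
    exact mem_iUnion₂.2 ⟨x, hx, ⟨ha, hax⟩, hay⟩
  calc _ ≤ _ := measure_mono hsub
    _ ≤ ∑ x ∈ t, μHE[d - 1] (S ∩ Metric.closedBall x ρ ∩ Metric.closedBall y r) :=
        measure_biUnion_finset_le _ _
    _ ≤ ∑ x ∈ t, ENNReal.ofReal (2 ^ (d - 1) * (c * r ^ (d - 1))) :=
        Finset.sum_le_sum fun x hx => hloc x (ht x hx) y r hr
    _ ≤ _ := by
        rw [Finset.sum_const, nsmul_eq_mul, ← ENNReal.ofReal_natCast,
          ← ENNReal.ofReal_mul (by positivity)]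
        refine ENNReal.ofReal_le_ofReal ?_
        have : 0 ≤ 2 ^ (d - 1) * (c * r ^ (d - 1)) := by positivity
        nlinarith

lemma HasConeAt.comp {d : ℕ} {r₀ : ℝ} {φ : Pt d → ℝ} {I : Set ℝ} {g : Pt d ≃ᵃⁱ[ℝ] Pt d} {x : Pt d}
    (h : HasConeAt r₀ (φ ⁻¹' I) (g x)) : HasConeAt r₀ ((φ ∘ g) ⁻¹' I) x := by
  intro r hr hr0
  obtain ⟨K, y, h1, h2, h3, h4, h5, h6⟩ := h r hr hr0
  refine ⟨g ⁻¹' K, g.symm y, h1.preimage g.continuous, h2.affine_preimage g.toAffineEquiv.toAffineMap,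
    fun z hz => h3 hz, ?_, fun z hz => ?_, fun z hz => h6 ?_⟩
  · have := g.toHomeomorph.preimage_closure K
    rw [AffineIsometryEquiv.coe_toHomeomorph] at this
    rw [← this]
    exact h4
  · have := h5 hz
    rwa [Metric.mem_ball, g.dist_map] at this
  · rw [Metric.mem_ball] at hz ⊢
    rwa [← g.apply_symm_apply y, g.dist_map]

/-- Cone conditions on both sides of the interface and a bound on its surface measure, uniformly
over rigid motions. -/
lemma exists_interface_geometry {d : ℕ} {φ : Pt d → ℝ} (hφ : ContDiff ℝ 1 φ)
    (hφ0 : ∀ x, φ x = 0 → gradient φ x ≠ 0) (hb : Bornology.IsBounded {x | φ x ≤ 0}) :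
    ∃ r₀ > 0, ∃ A > 0, ∀ g : Pt d ≃ᵃⁱ[ℝ] Pt d,
      (∀ x ∈ interface (φ ∘ g), HasConeAt r₀ {y | (φ ∘ g) y < 0} x ∧
        HasConeAt r₀ {y | 0 < (φ ∘ g) y} x) ∧
      ∀ y r, 0 ≤ r → μHE[d - 1] (interface (φ ∘ g) ∩ Metric.closedBall y r) ≤
        ENNReal.ofReal (A * r ^ (d - 1)) := by
  have hS : IsCompact (interface φ) := Metric.isCompact_of_isClosed_isBounded
    (isClosed_eq hφ.continuous continuous_const) (hb.subset fun x hx => le_of_eq hx)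
  obtain ⟨r₁, hr₁, h1⟩ := exists_cone hφ hS hφ0 fun x hx => hx
  -- The outer side is the inner side of `-φ`.
  obtain ⟨r₂, hr₂, h2⟩ := exists_cone hφ.neg hS (fun x hx => by
    have : gradient (-φ) x = - gradient φ x := by simp [gradient, fderiv_neg]
    change gradient (-φ) x ≠ 0
    rw [this]
    exact neg_ne_zero.2 (hφ0 x hx)) fun x hx => by
      change -φ x = 0
      rw [show φ x = 0 from hx, neg_zero]
  obtain ⟨A, hA, h3⟩ := exists_interface_measure_bound hφ hS hφ0 fun x hx => hx
  have hpos : {y | -φ y < 0} = φ ⁻¹' Ioi 0 := by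
    ext y
    simp
  refine ⟨min r₁ r₂, by positivity, A, hA, fun g => ⟨fun x hx => ⟨?_, ?_⟩, fun y r hr => ?_⟩⟩
  · exact HasConeAt.comp (I := Iio 0) fun r hr hr0 =>
      h1 (g x) hx r hr (hr0.trans (min_le_left _ _))
  · refine HasConeAt.comp (I := Ioi 0) fun r hr hr0 => ?_
    have := h2 (g x) hx r hr (hr0.trans (min_le_right _ _))
    rwa [hpos] at this
  · have hpre : interface (φ ∘ g) ∩ Metric.closedBall y r =
        g ⁻¹' (interface φ ∩ Metric.closedBall (g y) r) := by
      ext z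
      simp [interface, g.dist_map]
    rw [hpre, g.isometry.euclideanHausdorffMeasure_preimage, g.surjective.range_eq, inter_univ]
    exact h3 _ _ hr

variable {d : ℕ} {Ω : Set (Pt d)}

/-! ### Cells of a triangulation -/

lemma isOpen_cell (s : Finset (Pt d)) : IsOpen (cell s) := isOpen_interior

lemma convex_cell (s : Finset (Pt d)) : Convex ℝ (cell s) := (convex_convexHull ℝ _).interior

lemma isCompact_hull (s : Finset (Pt d)) : IsCompact (convexHull ℝ (s : Set (Pt d))) :=
  s.finite_toSet.isCompact_convexHull (𝕜 := ℝ)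

lemma cell_subset_hull (s : Finset (Pt d)) : cell s ⊆ convexHull ℝ (s : Set (Pt d)) :=
  interior_subset

lemma isBounded_cell (s : Finset (Pt d)) : Bornology.IsBounded (cell s) :=
  (isCompact_hull s).isBounded.subset (cell_subset_hull s)

lemma Triangulation.cell_nonempty (𝒯 : Triangulation Ω) {s : Finset (Pt d)}
    (hs : s ∈ 𝒯.elements) : (cell s).Nonempty := by
  rw [cell, interior_convexHull_nonempty_iff_affineSpan_eq_top]
  have h := (𝒯.affineIndependent s hs).affineSpan_eq_top_iff_card_eq_finrank_add_one.2
    (by simp [𝒯.card_eq s hs])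
  simpa using h

lemma Triangulation.closure_cell (𝒯 : Triangulation Ω) {s : Finset (Pt d)}
    (hs : s ∈ 𝒯.elements) : closure (cell s) = convexHull ℝ (s : Set (Pt d)) := by
  rw [cell, (convex_convexHull ℝ _).closure_interior_eq_closure_of_nonempty_interior
    (𝒯.cell_nonempty hs), (isCompact_hull s).isClosed.closure_eq]

lemma volume_frontier_cell (s : Finset (Pt d)) : volume (frontier (cell s)) = 0 :=
  (convex_cell s).addHaar_frontier volume

lemma dist_le_size {s : Finset (Pt d)} {x y : Pt d} (hx : x ∈ convexHull ℝ (s : Set (Pt d)))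
    (hy : y ∈ convexHull ℝ (s : Set (Pt d))) : dist x y ≤ size s :=
  Metric.dist_le_diam_of_mem (isCompact_hull s).isBounded hx hy

lemma size_mono {s t : Finset (Pt d)} (h : s ⊆ t) : size s ≤ size t :=
  Metric.diam_mono (convexHull_mono (by exact_mod_cast h)) (isCompact_hull t).isBounded

lemma size_nonneg (s : Finset (Pt d)) : 0 ≤ size s := Metric.diam_nonneg

lemma Triangulation.size_pos (𝒯 : Triangulation Ω) (hd : 1 ≤ d) {s : Finset (Pt d)}
    (hs : s ∈ 𝒯.elements) : 0 < size s := by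
  have : Nontrivial (Pt d) := by
    have : Nonempty (Fin d) := ⟨⟨0, hd⟩⟩
    infer_instance
  have h2 : 1 < s.card := by
    rw [𝒯.card_eq s hs]
    omega
  obtain ⟨a, ha, b, hb, hab⟩ := Finset.one_lt_card.1 h2
  exact (dist_pos.2 hab).trans_le (dist_le_size (subset_convexHull ℝ _ ha)
    (subset_convexHull ℝ _ hb))

lemma affineSpan_ne_top_of_card_le {F : Finset (Pt d)} (hF : F.card ≤ d) :
    affineSpan ℝ (F : Set (Pt d)) ≠ ⊤ := by
  classical
  rcases F.eq_empty_or_nonempty with rfl | hne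
  · simp
  intro h
  have h1 : F.card = (F.card - 1) + 1 := by
    have := hne.card_pos
    omega
  have h2 := finrank_vectorSpan_image_finset_le ℝ (id : Pt d → Pt d) F h1
  rw [Finset.image_id, ← direction_affineSpan, h, AffineSubspace.direction_top, finrank_top,
    finrank_euclideanSpace_fin] at h2
  have := hne.card_pos
  omega

/-- By conformity the two closed simplices meet in the hull of at most `d` common vertices, which
lies in a proper affine subspace and has empty interior. -/
lemma Triangulation.disjoint_cell (𝒯 : Triangulation Ω) {s t : Finset (Pt d)}
    (hs : s ∈ 𝒯.elements) (ht : t ∈ 𝒯.elements) (hst : s ≠ t) : Disjoint (cell s) (cell t) := by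
  classical
  have hcard : (s ∩ t).card ≤ d := by
    by_contra h
    have h1 : s ∩ t = s := Finset.eq_of_subset_of_card_le Finset.inter_subset_left
      (by rw [𝒯.card_eq s hs]; omega)
    have h2 : s ∩ t = t := Finset.eq_of_subset_of_card_le Finset.inter_subset_right
      (by rw [𝒯.card_eq t ht]; omega)
    exact hst (h1.symm.trans h2)
  rw [disjoint_iff_inter_eq_empty, cell, cell, ← interior_inter, 𝒯.inter_eq s hs t ht]
  by_contra h
  have h1 := interior_convexHull_nonempty_iff_affineSpan_eq_top.1 (nonempty_iff_ne_empty.2 h)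
  rw [← Finset.coe_inter] at h1
  exact affineSpan_ne_top_of_card_le hcard h1

/-- In a convex open set covered by the mesh, any two classes of elements are linked by a facet. -/
lemma Triangulation.exists_facet_between (𝒯 : Triangulation Ω) {K : Set (Pt d)} (hKo : IsOpen K)
    (hKc : Convex ℝ K) (hK : K ⊆ closure Ω) (A : Finset (Pt d) → Prop) {s₀ t₀ : Finset (Pt d)}
    (hs₀ : s₀ ∈ 𝒯.elements) (ht₀ : t₀ ∈ 𝒯.elements) (hAs : A s₀) (hAt : ¬ A t₀)
    (hsK : (cell s₀ ∩ K).Nonempty) (htK : (cell t₀ ∩ K).Nonempty) :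
    ∃ s ∈ 𝒯.elements, ∃ t ∈ 𝒯.elements, A s ∧ ¬ A t ∧ (cell s ∩ K).Nonempty ∧
      (cell t ∩ K).Nonempty ∧ (s ∩ t).card = d := by
  classical
  by_contra hcon
  push Not at hcon
  set E := 𝒯.elements.filter fun s => (cell s ∩ K).Nonempty with hE
  set P := (E ×ˢ E).filter fun p => A p.1 ∧ ¬ A p.2 with hP
  have hcard : ∀ p ∈ P, (p.1 ∩ p.2).card < d := by
    rintro ⟨s, t⟩ hp
    simp only [hP, hE, Finset.mem_filter, Finset.mem_product] at hp
    obtain ⟨⟨⟨hs, hsK⟩, ht, htK⟩, hA, hA'⟩ := hp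
    refine lt_of_le_of_ne ?_ (hcon s hs t ht hA hA' hsK htK)
    change (s ∩ t).card ≤ d
    by_contra h
    have h1 : s ∩ t = s := Finset.eq_of_subset_of_card_le Finset.inter_subset_left
      (by rw [𝒯.card_eq s hs]; omega)
    have h2 : s ∩ t = t := Finset.eq_of_subset_of_card_le Finset.inter_subset_right
      (by rw [𝒯.card_eq t ht]; omega)
    exact hA' (h1.symm.trans h2 ▸ hA)
  -- General position: finitely many proper affine subspaces are null sets and cannot fill a
  -- nonempty open set.
  have hnull : ∀ F : (Finset (Pt d) × Finset (Pt d)) → Finset (Pt d), (∀ p ∈ P, (F p).card ≤ d) →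
      ∀ U : Set (Pt d), IsOpen U → U.Nonempty →
      ∃ a ∈ U, ∀ p ∈ P, a ∉ affineSpan ℝ (F p : Set (Pt d)) := by
    intro F hF U hU hUne
    have h1 : volume (⋃ p ∈ P, (affineSpan ℝ (F p : Set (Pt d)) : Set (Pt d))) = 0 :=
      (measure_biUnion_null_iff P.countable_toSet).2 fun p hp =>
        Measure.addHaar_affineSubspace _ _ (affineSpan_ne_top_of_card_le (hF p hp))
    by_contra! hno
    have h2 : U ⊆ ⋃ p ∈ P, (affineSpan ℝ (F p : Set (Pt d)) : Set (Pt d)) := fun a ha => by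
      obtain ⟨p, hp, h⟩ := hno a ha
      exact mem_iUnion₂.2 ⟨p, hp, h⟩
    exact (hU.measure_pos volume hUne).ne' (measure_mono_null h2 h1)
  -- If no facet links the classes, elements of different classes meet in faces with fewer than `d`
  -- vertices. So `a` can avoid their spans, and then, adding `a` to such a face leaving at most `d`
  -- points, `b` can avoid the joins of `a` with them. The segment from `a` to `b` misses every such
  -- face. It is also connected, covered by the two closed unions of hulls and meets both, so it
  -- must hit one of these faces.
  obtain ⟨a, ha, haF⟩ := hnull (fun p => p.1 ∩ p.2) (fun p hp => (hcard p hp).le) _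
    ((isOpen_cell s₀).inter hKo) hsK
  obtain ⟨b, hb, hbF⟩ := hnull (fun p => insert a (p.1 ∩ p.2))
    (fun p hp => (Finset.card_insert_le _ _).trans (hcard p hp)) _
    ((isOpen_cell t₀).inter hKo) htK
  set U := ⋃ s ∈ E.filter A, convexHull ℝ (s : Set (Pt d)) with hU
  set V := ⋃ s ∈ E.filter (fun s => ¬ A s), convexHull ℝ (s : Set (Pt d)) with hV
  have hUc : IsClosed U := isClosed_biUnion_finset fun s _ => (isCompact_hull s).isClosed
  have hVc : IsClosed V := isClosed_biUnion_finset fun s _ => (isCompact_hull s).isClosed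
  have hcov : segment ℝ a b ⊆ U ∪ V := by
    intro x hx
    have hxK : x ∈ K := hKc.segment_subset ha.2 hb.2 hx
    have hx' := hK hxK
    rw [← 𝒯.cover] at hx'
    obtain ⟨s, hs, hxs⟩ := mem_iUnion₂.1 hx'
    have hsE : s ∈ E := by
      refine Finset.mem_filter.2 ⟨hs, ?_⟩
      rw [← 𝒯.closure_cell hs] at hxs
      rw [inter_comm]
      exact mem_closure_iff.1 hxs K hKo hxK
    by_cases hA : A s
    · exact Or.inl (mem_iUnion₂.2 ⟨s, Finset.mem_filter.2 ⟨hsE, hA⟩, hxs⟩)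
    · exact Or.inr (mem_iUnion₂.2 ⟨s, Finset.mem_filter.2 ⟨hsE, hA⟩, hxs⟩)
  have haU : a ∈ U := mem_iUnion₂.2 ⟨s₀, Finset.mem_filter.2 ⟨Finset.mem_filter.2 ⟨hs₀, hsK⟩, hAs⟩,
    cell_subset_hull _ ha.1⟩
  have hbV : b ∈ V := mem_iUnion₂.2 ⟨t₀, Finset.mem_filter.2 ⟨Finset.mem_filter.2 ⟨ht₀, htK⟩, hAt⟩,
    cell_subset_hull _ hb.1⟩
  obtain ⟨x, hx, hxU, hxV⟩ := isPreconnected_closed_iff.1 (convex_segment a b).isPreconnected U V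
    hUc hVc hcov ⟨a, left_mem_segment ℝ a b, haU⟩ ⟨b, right_mem_segment ℝ a b, hbV⟩
  obtain ⟨s, hs, hxs⟩ := mem_iUnion₂.1 hxU
  obtain ⟨t, ht, hxt⟩ := mem_iUnion₂.1 hxV
  rw [Finset.mem_filter] at hs ht
  have hp : (s, t) ∈ P := Finset.mem_filter.2 ⟨Finset.mem_product.2 ⟨hs.1, ht.1⟩, hs.2, ht.2⟩
  have hxst : x ∈ affineSpan ℝ ((s ∩ t : Finset (Pt d)) : Set (Pt d)) := by
    have : x ∈ convexHull ℝ ((s : Set (Pt d)) ∩ t) := by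
      rw [← 𝒯.inter_eq s (Finset.mem_filter.1 hs.1).1 t (Finset.mem_filter.1 ht.1).1]
      exact ⟨hxs, hxt⟩
    rw [Finset.coe_inter]
    exact convexHull_subset_affineSpan _ this
  rw [segment_eq_image_lineMap] at hx
  obtain ⟨θ, -, rfl⟩ := hx
  -- A common point other than `a` determines, together with `a`, the line through `b`, so `b` would
  -- lie in the join that was avoided.
  rcases eq_or_ne θ 0 with rfl | hθ
  · rw [AffineMap.lineMap_apply_zero] at hxst
    exact haF _ hp hxst
  · refine hbF _ hp ?_
    set Q := affineSpan ℝ ((insert a (s ∩ t) : Finset (Pt d)) : Set (Pt d)) with hQ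
    have h1 : AffineMap.lineMap a b θ ∈ Q := affineSpan_mono ℝ (by simp) hxst
    have h2 : a ∈ Q := mem_affineSpan ℝ (by simp)
    have h3 := AffineMap.lineMap_mem θ⁻¹ h2 h1
    rwa [AffineMap.lineMap_lineMap_right, inv_mul_cancel₀ hθ, AffineMap.lineMap_apply_one] at h3

/-- A shape regular element contains large balls near each of its points. -/
lemma ShapeRegular.exists_ball_subset {σ : ℝ} {𝒯 : Triangulation Ω} (h : ShapeRegular σ 𝒯)
    {s : Finset (Pt d)} (hs : s ∈ 𝒯.elements) {y : Pt d} (hy : y ∈ closure (cell s)) {l η : ℝ}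
    (hl : 0 < l) (hl1 : l ≤ 1) (hη : l * size s < η) :
    ∃ z, Metric.ball z (l * (size s / σ)) ⊆ cell s ∩ Metric.ball y η := by
  obtain ⟨c, hc⟩ := h s hs
  -- The inscribed ball is contracted towards `y` by the homothety of ratio `l`. Convexity keeps it
  -- in the cell, and the image of the cell lies within `l * size s < η` of `y`.
  refine ⟨y + l • (c - y), fun v hv => ?_⟩
  set w := y + l⁻¹ • (v - y) with hw
  have hvw : v = y + l • (w - y) := by
    rw [hw, add_sub_cancel_left, smul_smul, mul_inv_cancel₀ hl.ne', one_smul, add_sub_cancel]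
  have hwc : w ∈ cell s := by
    refine hc ?_
    rw [mem_ball_iff_norm] at hv ⊢
    have : v - (y + l • (c - y)) = l • (w - c) := by
      rw [hvw]
      module
    rw [this, norm_smul, Real.norm_of_nonneg hl.le] at hv
    exact lt_of_mul_lt_mul_left hv hl.le
  have hyh : y ∈ convexHull ℝ (s : Set (Pt d)) := by
    rwa [← 𝒯.closure_cell hs]
  constructor
  · rw [hvw]
    exact (convex_convexHull ℝ _).add_smul_sub_mem_interior' (subset_closure hyh) hwc ⟨hl, hl1⟩
  · rw [mem_ball_iff_norm, hvw, add_sub_cancel_left, norm_smul, Real.norm_of_nonneg hl.le,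
      ← dist_eq_norm]
    exact (mul_le_mul_of_nonneg_left (dist_le_size (cell_subset_hull s hwc) hyh) hl.le).trans_lt hη

lemma exists_unit_orthogonal (hd : 2 ≤ d) (x : Pt d) : ∃ u : Pt d, ‖u‖ = 1 ∧ inner ℝ x u = 0 := by
  have h1 := Submodule.finrank_add_finrank_orthogonal (ℝ ∙ x)
  rw [finrank_euclideanSpace_fin] at h1
  have h2 : Module.finrank ℝ (ℝ ∙ x) ≤ 1 := by
    simpa using finrank_span_le_card (R := ℝ) ({x} : Set (Pt d))
  have h3 : (ℝ ∙ x)ᗮ ≠ ⊥ := fun h => by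
    rw [h, finrank_bot] at h1
    omega
  obtain ⟨u, hu, hu0⟩ := Submodule.exists_mem_ne_zero_of_ne_bot h3
  refine ⟨‖u‖⁻¹ • u, ?_, ?_⟩
  · rw [norm_smul, norm_inv, norm_norm, inv_mul_cancel₀ (norm_ne_zero_iff.2 hu0)]
  · rw [inner_smul_right, Submodule.mem_orthogonal_singleton_iff_inner_right.1 hu, mul_zero]

/-- Facets of a shape regular element are not degenerate. -/
lemma ShapeRegular.size_div_le_size_facet {σ : ℝ} {𝒯 : Triangulation Ω} (h : ShapeRegular σ 𝒯)
    (hd : 2 ≤ d) {s F : Finset (Pt d)} (hs : s ∈ 𝒯.elements) (hF : F ⊆ s) (hFd : F.card = d) :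
    size s / σ ≤ size F := by
  classical
  obtain ⟨c, hc⟩ := h s hs
  have hdiff : (s \ F).card = 1 := by
    rw [Finset.card_sdiff_of_subset hF, 𝒯.card_eq s hs, hFd]
    omega
  obtain ⟨v, hv⟩ := Finset.card_eq_one.1 hdiff
  obtain ⟨w, hw⟩ : F.Nonempty := Finset.card_pos.1 (by omega)
  -- Here `v` is the vertex opposite `F` and `w` a vertex of `F`. In a direction orthogonal to `v -
  -- w` the opposite vertex has the same height as `w`, so the whole simplex is in a slab of
  -- half-width `size F`; the slab must contain the inscribed ball.
  obtain ⟨u, hu1, hu⟩ := exists_unit_orthogonal hd (v - w)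
  have hsub : convexHull ℝ (s : Set (Pt d)) ⊆ {x | |inner ℝ u (x - w)| ≤ size F} := by
    refine convexHull_min (fun x hx => ?_) ?_
    · by_cases hxF : x ∈ F
      · have h1 := abs_real_inner_le_norm u (x - w)
        rw [hu1, one_mul, ← dist_eq_norm] at h1
        exact h1.trans (dist_le_size (subset_convexHull ℝ _ hxF) (subset_convexHull ℝ _ hw))
      · have : x ∈ s \ F := Finset.mem_sdiff.2 ⟨hx, hxF⟩
        rw [hv, Finset.mem_singleton] at this
        change |inner ℝ u (x - w)| ≤ size F
        rw [this, real_inner_comm, hu, abs_zero]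
        exact size_nonneg F
    · intro x hx y hy a b ha hb hab
      change |inner ℝ u _| ≤ _
      have h1 : a • x + b • y - w = a • (x - w) + b • (y - w) := by
        have : w = a • w + b • w := by rw [← add_smul, hab, one_smul]
        conv_lhs => rw [this]
        module
      rw [h1, inner_add_right, inner_smul_right, inner_smul_right]
      have hx' := abs_le.1 (show |inner ℝ u (x - w)| ≤ size F from hx)
      have hy' := abs_le.1 (show |inner ℝ u (y - w)| ≤ size F from hy)
      rw [abs_le]
      constructor <;> nlinarith [hx'.1, hx'.2, hy'.1, hy'.2]
  -- The inscribed ball is open, so its radius is approached from below.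
  refine le_of_forall_lt fun t ht => ?_
  rcases lt_or_ge t 0 with h0 | h0
  · exact h0.trans_le (size_nonneg F)
  obtain ⟨t', htt', ht'⟩ := exists_between ht
  refine htt'.trans_le ?_
  have hmem : ∀ τ : ℝ, |τ| = t' → |inner ℝ u (c - w) + τ| ≤ size F := by
    intro τ hτ
    have h1 : c + τ • u ∈ Metric.ball c (size s / σ) := by
      rw [mem_ball_iff_norm, add_sub_cancel_left, norm_smul, hu1, mul_one, Real.norm_eq_abs, hτ]
      exact ht'
    have h2 := hsub (cell_subset_hull s (hc h1))
    have h3 : c + τ • u - w = (c - w) + τ • u := by module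
    have h4 : inner ℝ u (c + τ • u - w) = inner ℝ u (c - w) + τ := by
      rw [h3, inner_add_right, inner_smul_right, real_inner_self_eq_norm_sq, hu1]
      ring
    rw [← h4]
    exact h2
  have h1 := abs_le.1 (hmem t' (abs_of_nonneg (h0.trans htt'.le)))
  have h2 := abs_le.1 (hmem (-t') (by rw [abs_neg, abs_of_nonneg (h0.trans htt'.le)]))
  linarith [h1.1, h1.2, h2.1, h2.2]

/-- Packing bound: few elements of comparable size fit into a ball. -/
lemma ShapeRegular.card_le {σ : ℝ} {𝒯 : Triangulation Ω} (h : ShapeRegular σ 𝒯) (hσ : 0 < σ)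
    {E : Finset (Finset (Pt d))} (hE : E ⊆ 𝒯.elements) {a R : ℝ} (ha : 0 < a) (hR : 0 ≤ R)
    {y : Pt d} (hsize : ∀ s ∈ E, a ≤ size s) (hball : ∀ s ∈ E, cell s ⊆ Metric.closedBall y R) :
    (E.card : ℝ) ≤ (σ * R / a) ^ d := by
  have hv : 0 < volume.real (Metric.ball (0 : Pt d) 1) :=
    ENNReal.toReal_pos (Metric.measure_ball_pos volume _ one_pos).ne' measure_ball_lt_top.ne
  have h1 : ∀ s ∈ E, (a / σ) ^ d * volume.real (Metric.ball (0 : Pt d) 1) ≤ volume.real (cell s) := by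
    intro s hs
    obtain ⟨z, hz⟩ := h s (hE hs)
    have h2 : Metric.ball z (a / σ) ⊆ cell s :=
      (Metric.ball_subset_ball (div_le_div_of_nonneg_right (hsize s hs) hσ.le)).trans hz
    have h3 := measureReal_mono h2 (isBounded_cell s).measure_lt_top.ne (μ := volume)
    rwa [measureReal_def, Measure.addHaar_ball_of_pos _ _ (by positivity), ENNReal.toReal_mul,
      ENNReal.toReal_ofReal (by positivity), finrank_euclideanSpace_fin] at h3
  have h2 : ∑ s ∈ E, volume.real (cell s) ≤ volume.real (Metric.closedBall y R) := by
    rw [← measureReal_biUnion_finset (fun s hs t ht hst => 𝒯.disjoint_cell (hE hs) (hE ht) hst)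
      (fun s _ => (isOpen_cell s).measurableSet) (fun s _ => (isBounded_cell s).measure_lt_top.ne)]
    exact measureReal_mono (iUnion₂_subset hball) measure_closedBall_lt_top.ne
  rw [Measure.addHaar_real_closedBall _ _ hR, finrank_euclideanSpace_fin] at h2
  have h3 := (Finset.card_nsmul_le_sum E _ _ h1).trans h2
  rw [nsmul_eq_mul, ← mul_assoc] at h3
  have h4 := le_of_mul_le_mul_right h3 hv
  rw [div_pow, mul_div_assoc', div_le_iff₀ (by positivity)] at h4
  rw [div_pow, mul_pow, le_div_iff₀ (by positivity)]
  linarith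

/-! ### Chains of elements along the interface -/

/-- A phase `ω` adjacent to `Γ`, resolved by a shape regular mesh whose elements crossed by `Γ`
have size comparable to `H`. -/
structure IsResolved (𝒯 : Triangulation Ω) (ω Γ : Set (Pt d)) (σ ρ κ H : ℝ) : Prop where
  shape : ShapeRegular σ 𝒯
  σ_pos : 0 < σ
  ρ_pos : 0 < ρ
  κ_pos : 0 < κ
  H_pos : 0 < H
  le_size : ∀ s ∈ 𝒯.elements, (cell s ∩ Γ).Nonempty → H / ρ ≤ size s
  size_le : ∀ s ∈ 𝒯.elements, (cell s ∩ Γ).Nonempty → size s ≤ ρ * H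
  cone : ∀ x ∈ Γ, HasConeAt (κ * H) ω x
  subset : ω ⊆ closure Ω
  isOpen : IsOpen ω
  cell_subset : ∀ s ∈ 𝒯.elements, ¬ (cell s ∩ Γ).Nonempty → (cell s ∩ ω).Nonempty → cell s ⊆ ω

lemma mem_elementsMeeting {𝒯 : Triangulation Ω} {ω : Set (Pt d)} {s : Finset (Pt d)} :
    s ∈ elementsMeeting 𝒯 ω ↔ s ∈ 𝒯.elements ∧ (cell s ∩ ω).Nonempty := by
  simp [elementsMeeting]

lemma mem_facetPairs {𝒯 : Triangulation Ω} {ω Γ : Set (Pt d)} {s t : Finset (Pt d)} :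
    (s, t) ∈ facetPairs 𝒯 ω Γ ↔ (s ∈ elementsMeeting 𝒯 ω ∧ t ∈ elementsMeeting 𝒯 ω) ∧
      (s ∩ t).card = d ∧ ((cell s ∩ Γ).Nonempty ∨ (cell t ∩ Γ).Nonempty) := by
  simp [facetPairs]

/-- Telescoping along a chain of elements; it will be used with `e` a strain component at a fixed
point. -/
lemma abs_sub_le_of_walk {V : Type*} {G : SimpleGraph V} (e : V → ℝ) {B : ℝ}
    (hB : ∀ a b, G.Adj a b → |e a - e b| ≤ B) {a b : V} (p : G.Walk a b) :
    |e a - e b| ≤ p.length * B := by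
  induction p with
  | nil => simp
  | cons h p ih =>
    rw [SimpleGraph.Walk.length_cons]
    push_cast
    have h1 := hB _ _ h
    have h2 := abs_sub_le (e _) (e _) (e _) |>.trans (add_le_add h1 ih)
    linarith

lemma cell_subset_closedBall {s : Finset (Pt d)} {x : Pt d} {a b : ℝ}
    (h : (cell s ∩ Metric.ball x a).Nonempty) (hb : size s ≤ b) :
    cell s ⊆ Metric.closedBall x (a + b) := by
  obtain ⟨y, hy, hyx⟩ := h
  intro z hz
  have h1 := dist_le_size (cell_subset_hull s hz) (cell_subset_hull s hy)
  have h2 := dist_triangle z y x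
  rw [Metric.mem_ball] at hyx
  rw [Metric.mem_closedBall]
  linarith

/-- Only boundedly many crossed elements meet a ball of radius comparable to `H`. -/
lemma IsResolved.card_le {𝒯 : Triangulation Ω} {ω Γ : Set (Pt d)} {σ ρ κ H : ℝ}
    (h : IsResolved 𝒯 ω Γ σ ρ κ H) {E : Finset (Finset (Pt d))} (hE : E ⊆ 𝒯.elements)
    (hEΓ : ∀ s ∈ E, (cell s ∩ Γ).Nonempty) {y : Pt d} {r : ℝ} (hr : 0 ≤ r)
    (hEy : ∀ s ∈ E, (cell s ∩ Metric.ball y (r * H)).Nonempty) :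
    (E.card : ℝ) ≤ (σ * ρ * (r + ρ)) ^ d := by
  have hρ := h.ρ_pos
  have hH := h.H_pos
  have := h.shape.card_le h.σ_pos hE (a := H / ρ) (R := r * H + ρ * H) (by positivity)
    (by positivity) (y := y) (fun s hs => h.le_size s (hE hs) (hEΓ s hs))
    (fun s hs => cell_subset_closedBall (hEy s hs) (h.size_le s (hE hs) (hEΓ s hs)))
  refine this.trans_eq ?_
  congr 1
  field_simp

/-- From every crossed element one reaches, through boundedly many facets of crossed elements, an
element that contains a large ball inside the phase. -/
lemma IsResolved.exists_chain {𝒯 : Triangulation Ω} {ω Γ : Set (Pt d)} {σ ρ κ H : ℝ}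
    (h : IsResolved 𝒯 ω Γ σ ρ κ H) (hd : 2 ≤ d) {T : Finset (Pt d)} (hT : T ∈ 𝒯.elements)
    {x : Pt d} (hxT : x ∈ cell T) (hxΓ : x ∈ Γ) :
    ∃ t ∈ elementsMeeting 𝒯 ω, ∃ z,
      Metric.ball z (min (min 1 (κ / (8 * ρ)) / (ρ * σ)) (min (1 / (ρ * σ)) (1 / 2) / σ) * H) ⊆
        cell t ∩ (ω ∩ Metric.ball x ((2 * κ + 1) * H)) ∧
      ∀ (e : Finset (Pt d) → ℝ) (B : ℝ), 0 ≤ B →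
        (∀ s t, (s, t) ∈ facetPairs 𝒯 ω Γ → (cell s ∩ Γ).Nonempty →
          (cell s ∩ Metric.ball x ((2 * κ + 1) * H)).Nonempty → |e s - e t| ≤ B) →
        |e T - e t| ≤ ((σ * ρ * (2 * κ + 1 + ρ)) ^ d + 1) * B := by
  classical
  have hσ := h.σ_pos
  have hρ := h.ρ_pos
  have hκ := h.κ_pos
  have hH := h.H_pos
  obtain ⟨K, y, hKo, hKc, hKω, hxK, hKb, hyK⟩ := h.cone x hxΓ (κ * H) (by positivity) le_rfl
  set R := 2 * κ + 1 with hR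
  have hKb' : K ⊆ Metric.ball x (R * H) :=
    hKb.trans (Metric.ball_subset_ball (by rw [hR]; nlinarith))
  have hTK : (cell T ∩ K).Nonempty := mem_closure_iff.1 hxK _ (isOpen_cell T) hxT
  have hyK' : y ∈ K := hyK (Metric.mem_ball_self (by positivity))
  obtain ⟨Tc, hTc, hyTc⟩ : ∃ s ∈ 𝒯.elements, y ∈ convexHull ℝ (s : Set (Pt d)) := by
    have := h.subset (hKω hyK')
    rw [← 𝒯.cover] at this
    simpa using this
  rw [← 𝒯.closure_cell hTc] at hyTc
  have hTcK : (cell Tc ∩ K).Nonempty := by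
    rw [inter_comm]
    exact mem_closure_iff.1 hyTc K hKo hyK'
  -- The walk stays among crossed elements meeting the cone. Their sizes are comparable to `H`, so
  -- packing bounds their number and hence the length of a path.
  set V := 𝒯.elements.filter fun s => (cell s ∩ Γ).Nonempty ∧ (cell s ∩ K).Nonempty with hV
  have hVmem : ∀ s, s ∈ V ↔ s ∈ 𝒯.elements ∧ (cell s ∩ Γ).Nonempty ∧ (cell s ∩ K).Nonempty :=
    fun s => by simp [hV]
  have hcard : (V.card : ℝ) ≤ (σ * ρ * (R + ρ)) ^ d := by
    exact h.card_le (Finset.filter_subset _ _) (fun s hs => ((hVmem s).1 hs).2.1) (by positivity)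
      (fun s hs => ((hVmem s).1 hs).2.2.mono (inter_subset_inter_right _ hKb'))
  let G : SimpleGraph V :=
    { Adj := fun a b => a ≠ b ∧ (a.1 ∩ b.1).card = d
      symm := ⟨fun a b hab => ⟨hab.1.symm, by rw [Finset.inter_comm]; exact hab.2⟩⟩
      loopless := ⟨fun a ha => ha.1 rfl⟩ }
  have hTV : T ∈ V := (hVmem T).2 ⟨hT, ⟨x, hxT, hxΓ⟩, hTK⟩
  have hpair : ∀ s t, s ∈ V → t ∈ 𝒯.elements → (cell t ∩ K).Nonempty → (s ∩ t).card = d →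
      (s, t) ∈ facetPairs 𝒯 ω Γ := by
    intro s t hs ht htK hst
    obtain ⟨hs1, hs2, hs3⟩ := (hVmem s).1 hs
    exact mem_facetPairs.2 ⟨⟨mem_elementsMeeting.2 ⟨hs1, hs3.mono (inter_subset_inter_right _ hKω)⟩,
      mem_elementsMeeting.2 ⟨ht, htK.mono (inter_subset_inter_right _ hKω)⟩⟩, hst, Or.inl hs2⟩
  have hreach : ∀ (s : V), G.Reachable ⟨T, hTV⟩ s → ∀ (e : Finset (Pt d) → ℝ) (B : ℝ), 0 ≤ B →
      (∀ s t, (s, t) ∈ facetPairs 𝒯 ω Γ → (cell s ∩ Γ).Nonempty →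
        (cell s ∩ Metric.ball x (R * H)).Nonempty → |e s - e t| ≤ B) →
      |e T - e s| ≤ (σ * ρ * (R + ρ)) ^ d * B := by
    intro s hs e B hB he
    obtain ⟨p, hp⟩ := hs.exists_isPath
    have h1 := abs_sub_le_of_walk (fun v : V => e v.1) (B := B) (fun a b hab => by
      obtain ⟨-, hb2, hb3⟩ := (hVmem _).1 b.2
      obtain ⟨-, ha2, ha3⟩ := (hVmem _).1 a.2
      exact he _ _ (hpair a b a.2 ((hVmem _).1 b.2).1 hb3 hab.2) ha2
        (ha3.mono (inter_subset_inter_right _ hKb'))) p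
    refine h1.trans (mul_le_mul_of_nonneg_right (le_trans ?_ hcard) hB)
    have h2 := hp.length_lt
    rw [Fintype.card_coe] at h2
    exact_mod_cast h2.le
  -- Either the walk reaches the element `Tc` holding the centre of the ball in the cone, or the
  -- reachable elements have a facet neighbour that is not crossed.
  by_cases hA : ∃ hs : Tc ∈ V, G.Reachable ⟨T, hTV⟩ ⟨Tc, hs⟩
  · obtain ⟨hTcV, hr⟩ := hA
    obtain ⟨-, hTcΓ, -⟩ := (hVmem Tc).1 hTcV
    refine ⟨Tc, mem_elementsMeeting.2 ⟨hTc, hTcK.mono (inter_subset_inter_right _ hKω)⟩, ?_⟩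
    have hsz := h.size_le Tc hTc hTcΓ
    have hsz' := h.le_size Tc hTc hTcΓ
    -- Since `size Tc ≤ ρ * H`, this ratio gives `l * size Tc ≤ κ * H / 8`, which keeps the
    -- contracted ball inside the ball of radius `κ * H / 4` about `y`.
    set l := min 1 (κ / (8 * ρ)) with hl
    have hl0 : 0 < l := by positivity
    obtain ⟨z, hz⟩ := h.shape.exists_ball_subset hTc hyTc hl0 (min_le_left _ _)
      (η := κ * H / 4) (by
        have h1 : l * size Tc ≤ κ / (8 * ρ) * (ρ * H) :=
          mul_le_mul (min_le_right _ _) hsz (size_nonneg _) (by positivity)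
        have h2 : κ / (8 * ρ) * (ρ * H) = κ * H / 8 := by
          field_simp
        have h3 : 0 < κ * H := by positivity
        linarith)
    refine ⟨z, fun v hv => ?_, fun e B hB he => ?_⟩
    · have hv' : v ∈ Metric.ball z (l * (size Tc / σ)) := by
        refine Metric.ball_subset_ball ?_ hv
        calc _ ≤ l / (ρ * σ) * H := mul_le_mul_of_nonneg_right (min_le_left _ _) hH.le
          _ = l * (H / ρ / σ) := by field_simp
          _ ≤ _ := by gcongr
      have hvK := hyK (hz hv').2
      exact ⟨(hz hv').1, hKω hvK, hKb' hvK⟩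
    · refine (hreach ⟨Tc, hTcV⟩ hr e B hB he).trans ?_
      linarith
  · obtain ⟨s, hs, t, ht, ⟨hsV, hsr⟩, hAt, hsK, htK, hst⟩ := 𝒯.exists_facet_between hKo hKc
      (hKω.trans h.subset) (fun s => ∃ hs : s ∈ V, G.Reachable ⟨T, hTV⟩ ⟨s, hs⟩) hT hTc
      ⟨hTV, SimpleGraph.Reachable.refl _⟩ hA hTK hTcK
    -- A crossed `t` would extend the walk. Uncrossed and meeting the phase, `t` lies entirely
    -- inside it.
    have htΓ : ¬ (cell t ∩ Γ).Nonempty := by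
      intro htΓ
      have htV : t ∈ V := (hVmem t).2 ⟨ht, htΓ, htK⟩
      refine hAt ⟨htV, hsr.trans (SimpleGraph.Adj.reachable ?_)⟩
      refine ⟨fun heq => ?_, hst⟩
      have : s = t := congrArg Subtype.val heq
      subst this
      exact hAt ⟨hsV, hsr⟩
    obtain ⟨-, hsΓ, -⟩ := (hVmem s).1 hsV
    have htω : (cell t ∩ ω).Nonempty := htK.mono (inter_subset_inter_right _ hKω)
    have htω' := h.cell_subset t ht htΓ htω
    refine ⟨t, mem_elementsMeeting.2 ⟨ht, htω⟩, ?_⟩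
    have hsz : H / (ρ * σ) ≤ size t := by
      calc H / (ρ * σ) = H / ρ / σ := by field_simp
        _ ≤ size s / σ := div_le_div_of_nonneg_right (h.le_size s hs hsΓ) hσ.le
        _ ≤ size (s ∩ t) := h.shape.size_div_le_size_facet hd hs Finset.inter_subset_left hst
        _ ≤ size t := size_mono Finset.inter_subset_right
    have hst0 : 0 < size t := lt_of_lt_of_le (by positivity) hsz
    obtain ⟨v, hvt, hvK⟩ := htK
    -- The shared facet bounds the size of `t` from below only. Not being crossed, `t` may be much
    -- larger than `H`, hence the cap that keeps the ball near `x`.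
    set l := min 1 (H / 2 / size t) with hl
    have hl0 : 0 < l := by positivity
    have hls : l * size t = min (size t) (H / 2) := by
      rw [hl, min_mul_of_nonneg _ _ hst0.le, one_mul, div_mul_cancel₀ _ hst0.ne']
    obtain ⟨z, hz⟩ := h.shape.exists_ball_subset ht (subset_closure hvt) hl0 (min_le_left _ _)
      (η := H) (by
        rw [hls]
        exact (min_le_right _ _).trans_lt (by linarith))
    refine ⟨z, fun w hw => ?_, fun e B hB he => ?_⟩
    · have hw' : w ∈ Metric.ball z (l * (size t / σ)) := by
        refine Metric.ball_subset_ball ?_ hw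
        calc _ ≤ min (1 / (ρ * σ)) (1 / 2) / σ * H :=
              mul_le_mul_of_nonneg_right (min_le_right _ _) hH.le
          _ = min (1 / (ρ * σ) * H) (1 / 2 * H) / σ := by
              rw [← min_mul_of_nonneg _ _ hH.le]
              ring
          _ ≤ min (size t) (H / 2) / σ := by
              gcongr
              · rwa [one_div_mul_eq_div]
              · linarith
          _ = _ := by rw [← hls]; ring
      refine ⟨(hz hw').1, htω' (hz hw').1, ?_⟩
      have h1 := hKb hvK
      have h2 := (hz hw').2
      rw [Metric.mem_ball] at h1 h2 ⊢
      have := dist_triangle w v x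
      rw [hR]
      linarith
    · have h1 := hreach ⟨s, hsV⟩ hsr e B hB he
      have h2 := he s t (hpair s t hsV ht ⟨v, hvt, hvK⟩ hst) hsΓ
        (hsK.mono (inter_subset_inter_right _ hKb'))
      have := (abs_sub_le (e T) (e s) (e t)).trans (add_le_add h1 h2)
      linarith

/-! ### Piecewise polynomial functions -/

/-- `u` is polynomial of degree at most `m` on every element meeting `ω`. -/
def IsPiecewisePoly (m : ℕ) (𝒯 : Triangulation Ω) (ω : Set (Pt d)) (u : Pt d → Pt d) : Prop :=
  ∀ s ∈ elementsMeeting 𝒯 ω, ∃ p, IsPolyMap m p ∧ EqOn u p (cell s)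

section

variable {m : ℕ} {𝒯 : Triangulation Ω} {ω : Set (Pt d)} {u : Pt d → Pt d}

lemma IsPiecewisePoly.isPolyMap_polyExt (hu : IsPiecewisePoly m 𝒯 ω u) {s : Finset (Pt d)}
    (hs : s ∈ elementsMeeting 𝒯 ω) : IsPolyMap m (polyExt m s u) :=
  (Classical.epsilon_spec (hu s hs)).1

lemma IsPiecewisePoly.eqOn_polyExt (hu : IsPiecewisePoly m 𝒯 ω u) {s : Finset (Pt d)}
    (hs : s ∈ elementsMeeting 𝒯 ω) : EqOn u (polyExt m s u) (cell s) :=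
  (Classical.epsilon_spec (hu s hs)).2

lemma symGrad_congr {p : Pt d → Pt d} {U : Set (Pt d)} (hU : IsOpen U) (h : EqOn u p U) {x : Pt d}
    (hx : x ∈ U) : symGrad u x = symGrad p x := by
  have : u =ᶠ[nhds x] p := h.eventuallyEq_of_mem (hU.mem_nhds hx)
  funext i j
  simp only [symGrad, this.fderiv_eq]

lemma IsPiecewisePoly.symGrad_eq (hu : IsPiecewisePoly m 𝒯 ω u) {s : Finset (Pt d)}
    (hs : s ∈ elementsMeeting 𝒯 ω) {x : Pt d} (hx : x ∈ cell s) :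
    symGrad u x = symGrad (polyExt m s u) x :=
  symGrad_congr (isOpen_cell s) (hu.eqOn_polyExt hs) hx

lemma IsPiecewisePoly.integrableOn_cell (hu : IsPiecewisePoly m 𝒯 ω u) {s : Finset (Pt d)}
    (hs : s ∈ elementsMeeting 𝒯 ω) :
    IntegrableOn (fun x => frob (symGrad u x) (symGrad u x)) (cell s) := by
  refine (integrableOn_of_continuous (hu.isPolyMap_polyExt hs).continuous_frob
    (isBounded_cell s)).congr_fun (fun x hx => ?_) (isOpen_cell s).measurableSet
  simp only [hu.symGrad_eq hs hx]

lemma IsPiecewisePoly.integrableOn_biUnion (hu : IsPiecewisePoly m 𝒯 ω u) :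
    IntegrableOn (fun x => frob (symGrad u x) (symGrad u x)) (⋃ s ∈ elementsMeeting 𝒯 ω, cell s) :=
  (integrableOn_finset_iUnion).2 fun _ hs => hu.integrableOn_cell hs

/-- Cells are convex, so their boundaries are null and volume integrals may ignore the mesh
skeleton. -/
lemma biUnion_hull_ae_le (E : Finset (Finset (Pt d))) (hE : E ⊆ 𝒯.elements) :
    (⋃ s ∈ E, convexHull ℝ (s : Set (Pt d)) : Set (Pt d)) ≤ᵐ[volume] (⋃ s ∈ E, cell s : Set (Pt d)) := by
  have hnull : volume (⋃ s ∈ E, frontier (cell s)) = 0 :=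
    (measure_biUnion_null_iff E.countable_toSet).2 fun s _ => volume_frontier_cell s
  rw [ae_le_set]
  refine measure_mono_null (fun x hx => ?_) hnull
  obtain ⟨s, hs, hxs⟩ := mem_iUnion₂.1 hx.1
  refine mem_iUnion₂.2 ⟨s, hs, ?_⟩
  rw [← 𝒯.closure_cell (hE hs)] at hxs
  refine ⟨hxs, fun h => hx.2 (mem_iUnion₂.2 ⟨s, hs, interior_subset h⟩)⟩

lemma elementsMeeting_subset (𝒯 : Triangulation Ω) (ω : Set (Pt d)) :
    elementsMeeting 𝒯 ω ⊆ 𝒯.elements := fun _ hs => (mem_elementsMeeting.1 hs).1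

/-- Openness matters: a point of `ω` on the closure of an element has a neighbourhood in `ω`, so the
open cell already meets `ω`. -/
lemma phase_ae_le (hω : IsOpen ω) (hsub : ω ⊆ closure Ω) :
    (ω : Set (Pt d)) ≤ᵐ[volume] (⋃ s ∈ elementsMeeting 𝒯 ω, cell s : Set (Pt d)) := by
  refine Filter.EventuallyLE.trans ?_ (biUnion_hull_ae_le _ (elementsMeeting_subset 𝒯 ω))
  refine LE.le.eventuallyLE fun x hx => ?_
  have h1 := hsub hx
  rw [← 𝒯.cover] at h1
  obtain ⟨s, hs, hxs⟩ := mem_iUnion₂.1 h1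
  refine mem_iUnion₂.2 ⟨s, mem_elementsMeeting.2 ⟨hs, ?_⟩, hxs⟩
  rw [← 𝒯.closure_cell hs] at hxs
  rw [inter_comm]
  exact mem_closure_iff.1 hxs ω hω hx

lemma extDomain_ae_le :
    (extDomain 𝒯 ω : Set (Pt d)) ≤ᵐ[volume] (⋃ s ∈ elementsMeeting 𝒯 ω, cell s : Set (Pt d)) := by
  refine Filter.EventuallyLE.trans ?_ (biUnion_hull_ae_le _ (elementsMeeting_subset 𝒯 ω))
  refine LE.le.eventuallyLE fun x hx => ?_
  obtain ⟨s, hs, hxs⟩ := mem_iUnion₂.1 (interior_subset hx)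
  rw [𝒯.closure_cell (elementsMeeting_subset 𝒯 ω hs)] at hxs
  exact mem_iUnion₂.2 ⟨s, hs, hxs⟩

lemma IsPiecewisePoly.setIntegral_le_sum (hu : IsPiecewisePoly m 𝒯 ω u) {U : Set (Pt d)}
    (hU : U ≤ᵐ[volume] (⋃ s ∈ elementsMeeting 𝒯 ω, cell s : Set (Pt d))) :
    ∫ x in U, frob (symGrad u x) (symGrad u x) ≤
      ∑ s ∈ elementsMeeting 𝒯 ω, ∫ x in cell s, frob (symGrad u x) (symGrad u x) := by
  rw [← integral_biUnion_finset _ (fun s _ => (isOpen_cell s).measurableSet)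
    (fun s hs t ht hst => 𝒯.disjoint_cell (elementsMeeting_subset 𝒯 ω hs)
      (elementsMeeting_subset 𝒯 ω ht) hst) (fun s hs => hu.integrableOn_cell hs)]
  exact setIntegral_mono_set hu.integrableOn_biUnion
    (Filter.Eventually.of_forall fun x => frob_self_nonneg _) hU

lemma IsPiecewisePoly.sum_le_setIntegral (hu : IsPiecewisePoly m 𝒯 ω u) {U : Set (Pt d)}
    (hU : IntegrableOn (fun x => frob (symGrad u x) (symGrad u x)) U)
    {E : Finset (Finset (Pt d))} (hE : E ⊆ elementsMeeting 𝒯 ω) (hEU : ∀ s ∈ E, cell s ⊆ U) :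
    ∑ s ∈ E, ∫ x in cell s, frob (symGrad u x) (symGrad u x) ≤
      ∫ x in U, frob (symGrad u x) (symGrad u x) := by
  rw [← integral_biUnion_finset _ (fun s _ => (isOpen_cell s).measurableSet)
    (fun s hs t ht hst => 𝒯.disjoint_cell (elementsMeeting_subset 𝒯 ω (hE hs))
      (elementsMeeting_subset 𝒯 ω (hE ht)) hst) (fun s hs => hu.integrableOn_cell (hE hs))]
  exact setIntegral_mono_set hU (Filter.Eventually.of_forall fun x => frob_self_nonneg _)
    (iUnion₂_subset hEU).eventuallyLE

end

/-! ### The ghost penalty -/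

/-- The contribution of an ordered pair of neighbouring elements to the ghost penalty. -/
noncomputable def ghostTerm (m : ℕ) (u : Pt d → Pt d) (p : Finset (Pt d) × Finset (Pt d)) : ℝ :=
  1 / (size (p.1 ∩ p.2)) ^ 2 *
    ∫ x in cell p.1 ∪ cell p.2, ‖polyExt m p.1 u x - polyExt m p.2 u x‖ ^ 2

lemma ghostTerm_nonneg (m : ℕ) (u : Pt d → Pt d) (p : Finset (Pt d) × Finset (Pt d)) :
    0 ≤ ghostTerm m u p :=
  mul_nonneg (by positivity) (integral_nonneg fun _ => by positivity)

lemma ghostForm_self (γ : ℝ) (m : ℕ) (𝒯 : Triangulation Ω) (ω Γ : Set (Pt d)) (u : Pt d → Pt d) :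
    ghostForm γ m 𝒯 ω Γ u u = γ * (1 / 2 * ∑ p ∈ facetPairs 𝒯 ω Γ, ghostTerm m u p) := by
  simp only [ghostForm, ghostTerm, real_inner_self_eq_norm_sq]

/-- Local estimate: on a crossed element the strain is controlled by the strain in the phase and the
ghost penalty nearby. -/
lemma exists_local_bound (m : ℕ) (hd : 2 ≤ d) {σ ρ κ : ℝ} (hσ : 0 < σ) (hρ : 0 < ρ) (hκ : 0 < κ) :
    ∃ C > 0, ∀ (Ω : Set (Pt d)) (𝒯 : Triangulation Ω) (ω Γ : Set (Pt d)) (H : ℝ),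
      IsResolved 𝒯 ω Γ σ ρ κ H → ∀ u, IsPiecewisePoly m 𝒯 ω u →
      IntegrableOn (fun x => frob (symGrad u x) (symGrad u x)) ω →
      ∀ T ∈ elementsMeeting 𝒯 ω, ∀ x ∈ cell T, x ∈ Γ →
      ∀ E ⊆ facetPairs 𝒯 ω Γ,
      (∀ p ∈ facetPairs 𝒯 ω Γ, (cell p.1 ∩ Γ).Nonempty →
        (cell p.1 ∩ Metric.ball x ((2 * κ + 1) * H)).Nonempty → p ∈ E) →
      ∫ y in cell T, frob (symGrad u y) (symGrad u y) ≤
        C * (∑ p ∈ E, ghostTerm m u p +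
          ∫ y in ω ∩ Metric.ball x ((2 * κ + 1) * H), frob (symGrad u y) (symGrad u y)) := by
  set R := 2 * κ + 1 with hR
  have hR0 : 0 < R := by positivity
  set c := min (min 1 (κ / (8 * ρ)) / (ρ * σ)) (min (1 / (ρ * σ)) (1 / 2) / σ) with hc
  have hc0 : 0 < c := by positivity
  set M := (σ * ρ * (R + ρ)) ^ d + 1 with hM
  have hM0 : 0 < M := by positivity
  -- The ratios measure distances in ball radii. A point of `T` is within `(ρ + R) * H` of the
  -- centre of the last ball, of radius `c * H`. It is within `(R + 2 * ρ) * H` of the incentre of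
  -- an element of the chain, around which a ball of radius `H / (ρ * σ)` fits.
  obtain ⟨C3, hC3, h3⟩ := exists_symGrad_bound d m ((ρ + R) / c)
  obtain ⟨C4, hC4, h4⟩ := exists_symGrad_bound_norm d m ((R + 2 * ρ) * (ρ * σ))
  set C5 := C4 * (ρ * σ) ^ (d + 2) * ρ ^ 2 with hC5
  have hC50 : 0 < C5 := by positivity
  set C6 := 2 * M ^ 2 * C5 + 2 * (C3 / c ^ d) with hC6
  have hC60 : 0 < C6 := by positivity
  set v := volume.real (Metric.ball (0 : Pt d) 1) with hv
  have hv0 : 0 ≤ v := measureReal_nonneg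
  refine ⟨d ^ 2 * C6 * ρ ^ d * (v + 1), by positivity, ?_⟩
  intro Ω 𝒯 ω Γ H h u hu hint T hT x hxT hxΓ E hE hE'
  have hH := h.H_pos
  have hTel := (mem_elementsMeeting.1 hT).1
  have hTsize := h.size_le T hTel ⟨x, hxT, hxΓ⟩
  obtain ⟨t, ht, z, hz, hchain⟩ := h.exists_chain hd hTel hxT hxΓ
  set J := ∑ p ∈ E, ghostTerm m u p with hJ
  have hJ0 : 0 ≤ J := Finset.sum_nonneg fun p _ => ghostTerm_nonneg m u p
  set I := ∫ y in ω ∩ Metric.ball x (R * H), frob (symGrad u y) (symGrad u y) with hI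
  have hI0 : 0 ≤ I := integral_nonneg fun y => frob_self_nonneg _
  have hcellT : cell T ⊆ Metric.closedBall x (ρ * H) := fun y hy =>
    (dist_le_size (cell_subset_hull T hy) (cell_subset_hull T hxT)).trans hTsize
  have hpt : ∀ y ∈ cell T, ∀ i j, symGrad (polyExt m T u) y i j ^ 2 ≤ C6 / H ^ d * (J + I) := by
    intro y hy i j
    have hyx : dist y x ≤ ρ * H := hcellT hy
    set B := Real.sqrt (C5 / H ^ d * J) with hB
    have hB2 : B ^ 2 = C5 / H ^ d * J := Real.sq_sqrt (by positivity)
    -- The chain is applied to one strain component of the extended polynomials, all evaluated at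
    -- the same point `y` of `T`.
    have hstep := hchain (fun s => symGrad (polyExt m s u) y i j) B (Real.sqrt_nonneg _) (by
      intro s s' hp hsΓ hsx
      obtain ⟨⟨hs, hs'⟩, hcard, -⟩ := mem_facetPairs.1 hp
      have hsel := (mem_elementsMeeting.1 hs).1
      have hssize := h.size_le s hsel hsΓ
      have hssize' := h.le_size s hsel hsΓ
      obtain ⟨w, hw⟩ := h.shape s hsel
      set a := H / (ρ * σ) with ha
      have ha0 : 0 < a := by positivity
      have has : a ≤ size s / σ := by
        rw [ha, ← div_div]
        exact div_le_div_of_nonneg_right hssize' hσ.le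
      have hwa : Metric.ball w a ⊆ cell s := (Metric.ball_subset_ball has).trans hw
      have hwx := cell_subset_closedBall hsx hssize (hwa (Metric.mem_ball_self ha0))
      have hyw : y ∈ Metric.closedBall w ((R + 2 * ρ) * (ρ * σ) * a) := by
        rw [Metric.mem_closedBall] at hwx ⊢
        have h1 := dist_triangle_right y w x
        have h2 : (R + 2 * ρ) * (ρ * σ) * a = (R + 2 * ρ) * H := by
          rw [ha]
          field_simp
        rw [h2]
        linarith
      have hps := hu.isPolyMap_polyExt hs
      have hps' := hu.isPolyMap_polyExt hs'
      have h1 := h4 _ (hps.sub hps') w a ha0 y hyw i j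
      rw [symGrad_sub (hps.differentiable y) (hps'.differentiable y)] at h1
      refine Real.abs_le_sqrt (h1.trans ?_)
      have hcont : Continuous fun y => ‖(polyExt m s u - polyExt m s' u) y‖ ^ 2 :=
        ((hps.sub hps').contDiff.continuous.norm.pow 2)
      have h2 : ∫ z in Metric.ball w a, ‖(polyExt m s u - polyExt m s' u) z‖ ^ 2 ≤
          ∫ z in cell s ∪ cell s', ‖(polyExt m s u - polyExt m s' u) z‖ ^ 2 :=
        setIntegral_mono_set
          (integrableOn_of_continuous hcont ((isBounded_cell s).union (isBounded_cell s')))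
          (Filter.Eventually.of_forall fun _ => by positivity)
          ((hwa.trans subset_union_left).eventuallyLE)
      have hf0 : 0 < size (s ∩ s') := lt_of_lt_of_le (ha0.trans_le has)
        (h.shape.size_div_le_size_facet hd hsel Finset.inter_subset_left hcard)
      have h5 : ∫ z in cell s ∪ cell s', ‖(polyExt m s u - polyExt m s' u) z‖ ^ 2 =
          size (s ∩ s') ^ 2 * ghostTerm m u (s, s') := by
        simp only [ghostTerm, Pi.sub_apply]
        field_simp
      have h6 : ghostTerm m u (s, s') ≤ J :=
        Finset.single_le_sum (f := ghostTerm m u) (fun p _ => ghostTerm_nonneg m u p)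
          (hE' (s, s') hp hsΓ hsx)
      have h7 : size (s ∩ s') ^ 2 ≤ (ρ * H) ^ 2 :=
        pow_le_pow_left₀ hf0.le ((size_mono Finset.inter_subset_left).trans hssize) 2
      -- The inverse estimate costs `a ^ (-(d + 2))` with `a` comparable to `H`. The facet weight
      -- gives back at most `(ρ * H) ^ 2`, which leaves the scaling `H ^ (-d)` of a mean value.
      calc _ ≤ C4 / a ^ (d + 2) * ((ρ * H) ^ 2 * J) := by
            refine mul_le_mul_of_nonneg_left ?_ (by positivity)
            rw [h5] at h2
            exact h2.trans (mul_le_mul h7 h6 (ghostTerm_nonneg m u _) (by positivity))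
        _ = C5 / H ^ d * J := by
            rw [ha, hC5, div_pow, pow_add H d 2]
            field_simp)
    have hfat : symGrad (polyExt m t u) y i j ^ 2 ≤ C3 / c ^ d / H ^ d * I := by
      have hcH : 0 < c * H := by positivity
      have hyz : y ∈ Metric.closedBall z ((ρ + R) / c * (c * H)) := by
        have h1 := (hz (Metric.mem_ball_self hcH)).2.2
        rw [Metric.mem_ball] at h1
        have h2 := dist_triangle_right y z x
        have h6 : (ρ + R) / c * (c * H) = (ρ + R) * H := by
          field_simp
        rw [h6, Metric.mem_closedBall]
        linarith
      refine (h3 _ (hu.isPolyMap_polyExt ht) z (c * H) hcH y hyz i j).trans ?_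
      rw [mul_pow, ← div_div]
      refine mul_le_mul_of_nonneg_left ?_ (by positivity)
      have h1 : ∫ w in Metric.ball z (c * H), frob (symGrad (polyExt m t u) w) (symGrad (polyExt m t u) w) =
          ∫ w in Metric.ball z (c * H), frob (symGrad u w) (symGrad u w) :=
        setIntegral_congr_fun Metric.isOpen_ball.measurableSet fun w hw => by
          simp only [hu.symGrad_eq ht (hz hw).1]
      rw [h1]
      exact setIntegral_mono_set (hint.mono_set inter_subset_left)
        (Filter.Eventually.of_forall fun _ => frob_self_nonneg _)
        (LE.le.eventuallyLE fun w hw => (hz hw).2)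
    have h1 : |symGrad (polyExt m T u) y i j| ≤ M * B + |symGrad (polyExt m t u) y i j| := by
      have := abs_sub_abs_le_abs_sub (symGrad (polyExt m T u) y i j) (symGrad (polyExt m t u) y i j)
      linarith
    have h2 := pow_le_pow_left₀ (abs_nonneg _) h1 2
    rw [sq_abs] at h2
    calc _ ≤ _ := h2
      _ ≤ 2 * M ^ 2 * B ^ 2 + 2 * symGrad (polyExt m t u) y i j ^ 2 := by
          rw [← sq_abs (symGrad (polyExt m t u) y i j)]
          nlinarith [sq_nonneg (M * B - |symGrad (polyExt m t u) y i j|)]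
      _ ≤ 2 * M ^ 2 * (C5 / H ^ d * J) + 2 * (C3 / c ^ d / H ^ d * I) := by
          rw [hB2]
          linarith
      _ ≤ (2 * M ^ 2 * (C5 / H ^ d * J) + 2 * (C3 / c ^ d / H ^ d * I)) +
          (2 * M ^ 2 * (C5 / H ^ d * I) + 2 * (C3 / c ^ d / H ^ d * J)) :=
          le_add_of_nonneg_right (by positivity)
      _ = _ := by
          rw [hC6]
          ring
  have hvol : volume.real (cell T) ≤ (ρ * H) ^ d * v := by
    refine (measureReal_mono hcellT measure_closedBall_lt_top.ne).trans_eq ?_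
    rw [Measure.addHaar_real_closedBall _ _ (by positivity), finrank_euclideanSpace_fin]
  calc ∫ y in cell T, frob (symGrad u y) (symGrad u y)
      ≤ ∫ y in cell T, d ^ 2 * (C6 / H ^ d * (J + I)) := by
        refine setIntegral_mono_on (hu.integrableOn_cell hT)
          (integrableOn_const (isBounded_cell T).measure_lt_top.ne) (isOpen_cell T).measurableSet
          fun y hy => ?_
        rw [hu.symGrad_eq hT hy]
        exact frob_self_le (hpt y hy)
    _ = volume.real (cell T) * (d ^ 2 * (C6 / H ^ d * (J + I))) := by
        rw [setIntegral_const, smul_eq_mul]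
    _ ≤ ((ρ * H) ^ d * (v + 1)) * (d ^ 2 * (C6 / H ^ d * (J + I))) := by
        refine mul_le_mul_of_nonneg_right (hvol.trans ?_) (by positivity)
        gcongr
        linarith
    _ = _ := by
        rw [mul_pow]
        field_simp

/-- The ghost penalty extends control of the strain from the phase to the extended domain. -/
lemma exists_ghost_bound (m : ℕ) (hd : 2 ≤ d) {σ ρ κ : ℝ} (hσ : 0 < σ) (hρ : 0 < ρ) (hκ : 0 < κ) :
    ∃ C > 0, ∀ (Ω : Set (Pt d)) (𝒯 : Triangulation Ω) (ω Γ : Set (Pt d)) (H : ℝ),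
      IsResolved 𝒯 ω Γ σ ρ κ H → ∀ u, IsPiecewisePoly m 𝒯 ω u →
      ∑ s ∈ elementsMeeting 𝒯 ω, ∫ y in cell s, frob (symGrad u y) (symGrad u y) ≤
        C * ((∫ y in ω, frob (symGrad u y) (symGrad u y)) + ghostForm 1 m 𝒯 ω Γ u u) := by
  classical
  obtain ⟨C, hC, hloc⟩ := exists_local_bound m hd hσ hρ hκ
  set R := 2 * κ + 1 with hR
  have hR0 : 0 < R := by positivity
  set M₁ := (σ * ρ * (R + ρ)) ^ d with hM₁
  set M₂ := (σ * ρ * (R + ρ + ρ)) ^ d with hM₂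
  have hM₁0 : 0 < M₁ := by positivity
  have hM₂0 : 0 < M₂ := by positivity
  -- `1` accounts for the uncrossed elements, which lie in the phase. `M₁` and `M₂` are overlap
  -- numbers for the balls and the facet pairs, and the factor 2 undoes the `1 / 2` in `ghostForm`.
  refine ⟨1 + C * (M₁ + 2 * M₂), by positivity, ?_⟩
  intro Ω 𝒯 ω Γ H h u hu
  have hH := h.H_pos
  set f : Pt d → ℝ := fun y => frob (symGrad u y) (symGrad u y) with hf
  have hf0 : ∀ y, 0 ≤ f y := fun y => frob_self_nonneg _
  have hint : IntegrableOn f ω :=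
    hu.integrableOn_biUnion.mono_set_ae (phase_ae_le h.isOpen h.subset)
  have hIω : 0 ≤ ∫ y in ω, f y := integral_nonneg hf0
  rw [ghostForm_self, one_mul]
  set J := ∑ p ∈ facetPairs 𝒯 ω Γ, ghostTerm m u p with hJ
  have hJ0 : 0 ≤ J := Finset.sum_nonneg fun p _ => ghostTerm_nonneg m u p
  rw [← Finset.sum_filter_add_sum_filter_not _ (fun s => (cell s ∩ Γ).Nonempty)]
  set E := (elementsMeeting 𝒯 ω).filter (fun s => (cell s ∩ Γ).Nonempty) with hE
  have hEel : E ⊆ 𝒯.elements := (Finset.filter_subset _ _).trans (elementsMeeting_subset 𝒯 ω)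
  have hEΓ : ∀ s ∈ E, (cell s ∩ Γ).Nonempty := fun s hs => (Finset.mem_filter.1 hs).2
  have hun : ∑ s ∈ (elementsMeeting 𝒯 ω).filter (fun s => ¬ (cell s ∩ Γ).Nonempty),
      ∫ y in cell s, f y ≤ ∫ y in ω, f y := by
    refine hu.sum_le_setIntegral hint (Finset.filter_subset _ _) fun s hs => ?_
    obtain ⟨h1, h2⟩ := Finset.mem_filter.1 hs
    exact h.cell_subset s (mem_elementsMeeting.1 h1).1 h2 (mem_elementsMeeting.1 h1).2
  have hpt : ∀ s : Finset (Pt d), ∃ x, s ∈ E → x ∈ cell s ∩ Γ := by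
    intro s
    by_cases hs : s ∈ E
    · obtain ⟨x, hx⟩ := hEΓ s hs
      exact ⟨x, fun _ => hx⟩
    · exact ⟨0, fun h => absurd h hs⟩
  choose x hx using hpt
  let near (s : Finset (Pt d)) (p : Finset (Pt d) × Finset (Pt d)) : Prop :=
    (cell p.1 ∩ Γ).Nonempty ∧ (cell p.1 ∩ Metric.ball (x s) (R * H)).Nonempty
  have h1 : ∀ s ∈ E, ∫ y in cell s, f y ≤
      C * (∑ p ∈ (facetPairs 𝒯 ω Γ).filter (near s), ghostTerm m u p +
        ∫ y in ω ∩ Metric.ball (x s) (R * H), f y) := fun s hs =>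
    hloc Ω 𝒯 ω Γ H h u hu hint s (Finset.mem_filter.1 hs).1 (x s) (hx s hs).1 (hx s hs).2 _
      (Finset.filter_subset _ _) fun p hp hp1 hp2 => Finset.mem_filter.2 ⟨hp, hp1, hp2⟩
  -- Exchanging the sums leaves, for a fixed pair, the number of crossed elements whose chosen point
  -- is near its first element; packing bounds it.
  have h2 : ∑ s ∈ E, ∑ p ∈ (facetPairs 𝒯 ω Γ).filter (near s), ghostTerm m u p ≤ M₂ * J := by
    rw [Finset.sum_comm' (t' := facetPairs 𝒯 ω Γ) (s' := fun p => E.filter fun s => near s p)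
      (fun s p => by simp only [Finset.mem_filter]; tauto), hJ, Finset.mul_sum]
    refine Finset.sum_le_sum fun p hp => ?_
    rw [Finset.sum_const, nsmul_eq_mul]
    refine mul_le_mul_of_nonneg_right ?_ (ghostTerm_nonneg m u p)
    obtain ⟨⟨hp1, -⟩, -, -⟩ := mem_facetPairs.1 (show (p.1, p.2) ∈ _ from hp)
    have hp1' := (mem_elementsMeeting.1 hp1).1
    obtain ⟨y, hy⟩ := 𝒯.cell_nonempty hp1'
    refine h.card_le ((Finset.filter_subset _ _).trans hEel)
      (fun s hs => hEΓ s (Finset.mem_filter.1 hs).1) (by positivity) (y := y) fun s hs => ?_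
    obtain ⟨hsE, hpΓ, w, hw, hwx⟩ := Finset.mem_filter.1 hs
    refine ⟨x s, (hx s hsE).1, ?_⟩
    have h3 := (dist_le_size (cell_subset_hull _ hw) (cell_subset_hull _ hy)).trans
      (h.size_le _ hp1' hpΓ)
    rw [Metric.mem_ball] at hwx ⊢
    have h4 := dist_triangle_left (x s) y w
    linarith
  have h3 : ∑ s ∈ E, ∫ y in ω ∩ Metric.ball (x s) (R * H), f y ≤ M₁ * ∫ y in ω, f y := by
    have hind : ∀ s, ∫ y in ω ∩ Metric.ball (x s) (R * H), f y =
        ∫ y in ω, (Metric.ball (x s) (R * H)).indicator f y := fun s =>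
      (setIntegral_indicator Metric.isOpen_ball.measurableSet).symm
    have hind' : ∀ s, IntegrableOn ((Metric.ball (x s) (R * H)).indicator f) ω := fun s =>
      hint.indicator Metric.isOpen_ball.measurableSet
    simp only [hind]
    rw [← integral_finsetSum _ fun s _ => hind' s, ← integral_const_mul]
    refine integral_mono (integrable_finsetSum _ fun s _ => hind' s) (hint.const_mul _) fun y => ?_
    simp only [indicator_apply]
    rw [← Finset.sum_filter, Finset.sum_const, nsmul_eq_mul]
    refine mul_le_mul_of_nonneg_right ?_ (hf0 y)
    refine h.card_le ((Finset.filter_subset _ _).trans hEel)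
      (fun s hs => hEΓ s (Finset.mem_filter.1 hs).1) (by positivity) (y := y) fun s hs => ?_
    obtain ⟨hsE, hys⟩ := Finset.mem_filter.1 hs
    exact ⟨x s, (hx s hsE).1, Metric.mem_ball_comm.1 hys⟩
  have h4 : ∑ s ∈ E, ∫ y in cell s, f y ≤ C * (M₂ * J + M₁ * ∫ y in ω, f y) := by
    refine (Finset.sum_le_sum h1).trans ?_
    rw [← Finset.mul_sum, Finset.sum_add_distrib]
    exact mul_le_mul_of_nonneg_left (add_le_add h2 h3) hC.le
  refine (add_le_add h4 hun).trans ?_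
  have h5 : 0 ≤ C * M₂ * ∫ y in ω, f y := by positivity
  have h6 : 0 ≤ C * M₁ * J := by positivity
  nlinarith

/-! ### Traces on the interface -/

/-- Valid also where the gradient vanishes: there `normal` is zero. -/
lemma norm_normal_le (φ : Pt d → ℝ) (x : Pt d) : ‖normal φ x‖ ≤ 1 := by
  rw [normal, norm_smul, norm_inv, norm_norm]
  exact inv_mul_le_one

lemma measurable_normal {φ : Pt d → ℝ} (hφ : ContDiff ℝ 1 φ) : Measurable (normal φ) := by
  have hc : Continuous (gradient φ) :=
    (InnerProductSpace.toDual ℝ (Pt d)).symm.continuous.comp (hφ.continuous_fderiv one_ne_zero)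
  exact (hc.norm.measurable.inv).smul hc.measurable

lemma normalStrain_sq_le {φ : Pt d → ℝ} {u : Pt d → Pt d} {x : Pt d} {b : ℝ}
    (h : ∀ i j, symGrad u x i j ^ 2 ≤ b) : normalStrain φ u x ^ 2 ≤ d ^ 4 * b := by
  have hn : ∀ i, |normal φ x i| ≤ 1 := fun i =>
    (PiLp.norm_apply_le (normal φ x) i).trans (norm_normal_le φ x)
  have h1 : |normalStrain φ u x| ≤ ∑ _i : Fin d, ∑ _j : Fin d, √b := by
    refine (Finset.abs_sum_le_sum_abs _ _).trans (Finset.sum_le_sum fun i _ =>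
      (Finset.abs_sum_le_sum_abs _ _).trans (Finset.sum_le_sum fun j _ => ?_))
    rw [abs_mul, abs_mul]
    calc _ ≤ 1 * |symGrad u x i j| * 1 :=
          mul_le_mul (mul_le_mul_of_nonneg_right (hn i) (abs_nonneg _)) (hn j) (abs_nonneg _)
            (by positivity)
      _ = |symGrad u x i j| := by ring
      _ ≤ √b := Real.abs_le_sqrt (h i j)
  have h2 : (∑ _i : Fin d, ∑ _j : Fin d, √b) = d ^ 2 * √b := by
    simp
    ring
  rw [h2] at h1
  rcases Nat.eq_zero_or_pos d with rfl | hd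
  · simp [normalStrain]
  have hb : 0 ≤ b := (sq_nonneg _).trans (h ⟨0, hd⟩ ⟨0, hd⟩)
  calc normalStrain φ u x ^ 2 = |normalStrain φ u x| ^ 2 := (sq_abs _).symm
    _ ≤ (d ^ 2 * √b) ^ 2 := pow_le_pow_left₀ (abs_nonneg _) h1 2
    _ = _ := by
      rw [mul_pow, Real.sq_sqrt hb]
      ring

lemma IsPolyMap.measurable_normalStrain {m : ℕ} {p : Pt d → Pt d} (hp : IsPolyMap m p)
    {φ : Pt d → ℝ} (hφ : ContDiff ℝ 1 φ) : Measurable (normalStrain φ p) := by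
  have hn : ∀ i, Measurable fun x => normal φ x i := fun i =>
    (EuclideanSpace.proj i : Pt d →L[ℝ] ℝ).measurable.comp (measurable_normal hφ)
  exact Finset.measurable_sum _ fun i _ => Finset.measurable_sum _ fun j _ =>
    ((hn i).mul (hp.continuous_symGrad i j).measurable).mul (hn j)

section

variable {m : ℕ} {𝒯 : Triangulation Ω} {ω : Set (Pt d)} {ν : Measure (Pt d)} [IsFiniteMeasure ν]

lemma IsPiecewisePoly.memLp_normalStrain {u : Pt d → Pt d} (hu : IsPiecewisePoly m 𝒯 ω u)
    {φ : Pt d → ℝ} (hφ : ContDiff ℝ 1 φ) {s : Finset (Pt d)} (hs : s ∈ elementsMeeting 𝒯 ω) :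
    MemLp (normalStrain φ u) 2 (ν.restrict (cell s)) := by
  have hp := hu.isPolyMap_polyExt hs
  obtain ⟨b, hb⟩ := (isCompact_hull s).exists_bound_of_continuousOn hp.continuous_frob.continuousOn
  have h1 : MemLp (normalStrain φ (polyExt m s u)) 2 (ν.restrict (cell s)) := by
    refine MemLp.of_bound (hp.measurable_normalStrain hφ).aestronglyMeasurable
      (√(d ^ 4 * b)) ?_
    filter_upwards [ae_restrict_mem (isOpen_cell s).measurableSet] with x hx
    refine Real.abs_le_sqrt (normalStrain_sq_le fun i j => ?_)
    exact (sq_symGrad_le_frob _ i j).trans ((le_abs_self _).trans (hb x (cell_subset_hull s hx)))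
  refine h1.ae_eq ?_
  filter_upwards [ae_restrict_mem (isOpen_cell s).measurableSet] with x hx
  simp only [normalStrain, hu.symGrad_eq hs hx]

lemma memLp_jumpNormal {ω' : Set (Pt d)} {u : Field d} (hum : IsPiecewisePoly m 𝒯 ω u.minus)
    (hup : IsPiecewisePoly m 𝒯 ω' u.plus) {φ : Pt d → ℝ} (hφ : ContDiff ℝ 1 φ)
    {s : Finset (Pt d)} (hs : s ∈ elementsMeeting 𝒯 ω) (hs' : s ∈ elementsMeeting 𝒯 ω') :
    MemLp (jumpNormal φ u) 2 (ν.restrict (cell s)) := by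
  have key : ∀ p : Pt d → Pt d, IsPolyMap m p →
      MemLp (fun x => (inner ℝ (p x) (normal φ x) : ℝ)) 2 (ν.restrict (cell s)) := by
    intro p hp
    have hc := hp.contDiff.continuous
    obtain ⟨b, hb⟩ := (isCompact_hull s).exists_bound_of_continuousOn hc.continuousOn
    refine MemLp.of_bound (hc.measurable.inner (measurable_normal hφ)).aestronglyMeasurable b ?_
    filter_upwards [ae_restrict_mem (isOpen_cell s).measurableSet] with x hx
    calc _ ≤ ‖p x‖ * ‖normal φ x‖ := norm_inner_le_norm _ _
      _ ≤ ‖p x‖ * 1 := mul_le_mul_of_nonneg_left (norm_normal_le φ x) (norm_nonneg _)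
      _ ≤ b := by
          rw [mul_one]
          exact hb x (cell_subset_hull s hx)
  refine ((key _ (hum.isPolyMap_polyExt hs)).sub (key _ (hup.isPolyMap_polyExt hs'))).ae_eq ?_
  filter_upwards [ae_restrict_mem (isOpen_cell s).measurableSet] with x hx
  simp only [Pi.sub_apply, jumpNormal, hum.eqOn_polyExt hs hx, hup.eqOn_polyExt hs' hx]

end

/-- Discrete trace inequality for the normal strain on the part of the interface in an element. -/
lemma exists_trace_bound (m : ℕ) (hd : 2 ≤ d) {σ A : ℝ} (hσ : 0 < σ) (hA : 0 < A) :
    ∃ C > 0, ∀ (Ω : Set (Pt d)) (𝒯 : Triangulation Ω) (ω : Set (Pt d)), ShapeRegular σ 𝒯 →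
      ∀ u, IsPiecewisePoly m 𝒯 ω u → ∀ (φ : Pt d → ℝ) (ν : Measure (Pt d)),
      (∀ y r, 0 ≤ r → ν (Metric.closedBall y r) ≤ ENNReal.ofReal (A * r ^ (d - 1))) →
      ∀ s ∈ elementsMeeting 𝒯 ω, size s * ∫ x in cell s, normalStrain φ u x ^ 2 ∂ν ≤
        C * ∫ x in cell s, frob (symGrad u x) (symGrad u x) := by
  obtain ⟨C, hC, h⟩ := exists_symGrad_bound d m σ
  refine ⟨d ^ 4 * C * σ ^ d * A, by positivity, ?_⟩
  intro Ω 𝒯 ω hsh u hu φ ν hν s hs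
  have hsel := (mem_elementsMeeting.1 hs).1
  have hs0 := 𝒯.size_pos (by omega) hsel
  obtain ⟨w, hw⟩ := hsh s hsel
  set I := ∫ x in cell s, frob (symGrad u x) (symGrad u x) with hI
  have hI0 : 0 ≤ I := integral_nonneg fun _ => frob_self_nonneg _
  have hr : 0 < size s / σ := by positivity
  have hwc : w ∈ cell s := hw (Metric.mem_ball_self hr)
  have hcw : cell s ⊆ Metric.closedBall w (size s) := fun x hx =>
    dist_le_size (cell_subset_hull s hx) (cell_subset_hull s hwc)
  have hpt : ∀ x ∈ cell s, ‖normalStrain φ u x ^ 2‖ ≤ d ^ 4 * (C / (size s / σ) ^ d * I) := by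
    intro x hx
    rw [Real.norm_of_nonneg (sq_nonneg _)]
    refine normalStrain_sq_le fun i j => ?_
    rw [hu.symGrad_eq hs hx]
    refine (h _ (hu.isPolyMap_polyExt hs) w _ hr x ?_ i j).trans ?_
    · rw [mul_div_cancel₀ _ hσ.ne']
      exact hcw hx
    · refine mul_le_mul_of_nonneg_left ?_ (by positivity)
      have h1 : ∫ z in Metric.ball w (size s / σ),
          frob (symGrad (polyExt m s u) z) (symGrad (polyExt m s u) z) =
          ∫ z in Metric.ball w (size s / σ), frob (symGrad u z) (symGrad u z) :=
        setIntegral_congr_fun Metric.isOpen_ball.measurableSet fun z hz => by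
          simp only [hu.symGrad_eq hs (hw hz)]
      rw [h1]
      exact setIntegral_mono_set (hu.integrableOn_cell hs)
        (Filter.Eventually.of_forall fun _ => frob_self_nonneg _) hw.eventuallyLE
  have hνs : ν (cell s) ≤ ENNReal.ofReal (A * size s ^ (d - 1)) :=
    (measure_mono hcw).trans (hν w _ hs0.le)
  have hνr : ν.real (cell s) ≤ A * size s ^ (d - 1) :=
    ENNReal.toReal_le_of_le_ofReal (by positivity) hνs
  -- Sup bound times surface measure: the pointwise factor `size s ^ (-d)` is cancelled by `size s ^
  -- (d - 1)` from the measure and the `size s` in front.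
  have h2 := norm_setIntegral_le_of_norm_le_const (hνs.trans_lt ENNReal.ofReal_lt_top) hpt
  have h3 := (le_abs_self _).trans (h2.trans (mul_le_mul_of_nonneg_left hνr (by positivity)))
  refine (mul_le_mul_of_nonneg_left h3 hs0.le).trans_eq ?_
  have h4 : size s ^ d = size s ^ (d - 1) * size s := by
    rw [← pow_succ]
    congr 1
    omega
  rw [div_pow, h4]
  field_simp

/-! ### Resolved phases -/

lemma HasConeAt.mono {r₀ r₁ : ℝ} {ω : Set (Pt d)} {x : Pt d} (h : HasConeAt r₁ ω x) (hr : r₀ ≤ r₁) :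
    HasConeAt r₀ ω x := fun r h0 h1 => h r h0 (h1.trans hr)

lemma HasConeAt.mem_closure {r₀ : ℝ} {ω : Set (Pt d)} {x : Pt d} (h : HasConeAt r₀ ω x)
    (hr : 0 < r₀) : x ∈ closure ω := by
  obtain ⟨K, y, -, -, hK, hx, -⟩ := h r₀ hr le_rfl
  exact closure_mono hK hx

/-- The cone of parameter `r` lies within `2 * r ≤ δ` of a point of the interface, so it cannot
leave `Ω`. -/
lemma HasConeAt.phasePlus {r₀ δ : ℝ} {ψ : Pt d → ℝ} {x : Pt d} (hx : ψ x = 0)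
    (h : HasConeAt r₀ {y | 0 < ψ y} x) (hδ : Metric.cthickening δ {x | ψ x ≤ 0} ⊆ Ω) :
    HasConeAt (min r₀ (δ / 2)) (phasePlus Ω ψ) x := by
  intro r hr hr0
  obtain ⟨K, y, h1, h2, h3, h4, h5, h6⟩ := h r hr (hr0.trans (min_le_left _ _))
  refine ⟨K, y, h1, h2, fun z hz => ⟨hδ ?_, h3 hz⟩, h4, h5, h6⟩
  have h7 := hr0.trans (min_le_right _ _)
  refine Metric.mem_cthickening_of_dist_le z x δ _ hx.le ?_
  have h8 := Metric.mem_ball.1 (h5 hz)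
  linarith

lemma Triangulation.isBounded (𝒯 : Triangulation Ω) : Bornology.IsBounded Ω := by
  refine Bornology.IsBounded.subset ?_ subset_closure
  rw [← 𝒯.cover]
  exact (Bornology.isBounded_biUnion_finset _).2 fun s _ => (isCompact_hull s).isBounded

lemma Triangulation.size_le_diam (𝒯 : Triangulation Ω) {s : Finset (Pt d)}
    (hs : s ∈ 𝒯.elements) : size s ≤ Metric.diam Ω := by
  rw [← Metric.diam_closure]
  refine Metric.diam_mono ?_ 𝒯.isBounded.closure
  rw [← 𝒯.cover]
  exact subset_biUnion_of_mem (u := fun s : Finset (Pt d) => convexHull ℝ (s : Set (Pt d))) hs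

lemma Triangulation.size_le_meshSize (𝒯 : Triangulation Ω) {s : Finset (Pt d)}
    (hs : s ∈ 𝒯.elements) : size s ≤ meshSize 𝒯 :=
  le_csSup (𝒯.elements.finite_toSet.image _).bddAbove (mem_image_of_mem _ hs)

lemma mem_cutElements {𝒯 : Triangulation Ω} {Γ : Set (Pt d)} {s : Finset (Pt d)} :
    s ∈ cutElements 𝒯 Γ ↔ s ∈ 𝒯.elements ∧ (closure (cell s) ∩ Γ).Nonempty := by
  simp [cutElements]

lemma mem_cutElements_of_crossed {𝒯 : Triangulation Ω} {Γ : Set (Pt d)} {s : Finset (Pt d)}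
    (hs : s ∈ 𝒯.elements) (h : (cell s ∩ Γ).Nonempty) : s ∈ cutElements 𝒯 Γ :=
  mem_cutElements.2 ⟨hs, h.mono (inter_subset_inter_left _ subset_closure)⟩

/-- A cell is connected, so by the intermediate value theorem the level function cannot change sign
there without vanishing. -/
lemma cell_subset_of_sign {ψ : Pt d → ℝ} (hψ : Continuous ψ) {s : Finset (Pt d)}
    (h : ¬ (cell s ∩ interface ψ).Nonempty) :
    ((cell s ∩ {x | ψ x < 0}).Nonempty → cell s ⊆ {x | ψ x < 0}) ∧
    ((cell s ∩ {x | 0 < ψ x}).Nonempty → cell s ⊆ {x | 0 < ψ x}) := by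
  have hpre := (convex_cell s).isPreconnected
  have hz : ∀ a ∈ cell s, ∀ b ∈ cell s, ψ a < 0 → 0 < ψ b → False := by
    intro a ha b hb ha0 hb0
    obtain ⟨c, hc, hc0⟩ := hpre.intermediate_value ha hb hψ.continuousOn ⟨ha0.le, hb0.le⟩
    exact h ⟨c, hc, hc0⟩
  have hne : ∀ a ∈ cell s, ψ a ≠ 0 := fun a ha h0 => h ⟨a, ha, h0⟩
  constructor
  · rintro ⟨a, ha, ha0⟩ b hb
    rcases lt_trichotomy (ψ b) 0 with h1 | h1 | h1
    · exact h1
    · exact absurd h1 (hne b hb)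
    · exact (hz a ha b hb ha0 h1).elim
  · rintro ⟨a, ha, ha0⟩ b hb
    rcases lt_trichotomy (ψ b) 0 with h1 | h1 | h1
    · exact (hz b hb a ha h1 ha0).elim
    · exact absurd h1 (hne b hb)
    · exact h1

/-- Both phases are resolved by the mesh. -/
lemma exists_isResolved (hd : 2 ≤ d) {ψ : Pt d → ℝ} (hψ : Continuous ψ) (hΩ : IsOpen Ω)
    {δ σ ρ r₀ : ℝ} (hδ0 : 0 < δ) (hσ : 0 < σ) (hρ : 0 < ρ) (hr₀ : 0 < r₀)
    (hcone : ∀ x ∈ interface ψ, HasConeAt r₀ {y | ψ y < 0} x ∧ HasConeAt r₀ {y | 0 < ψ y} x)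
    (hδ : Metric.cthickening δ {x | ψ x ≤ 0} ⊆ Ω) (𝒯 : Triangulation Ω) (hsh : ShapeRegular σ 𝒯)
    (hqu : CutQuasiUniform ρ 𝒯 (interface ψ)) :
    ∃ H, IsResolved 𝒯 (phaseMinus ψ) (interface ψ) σ ρ (min r₀ (δ / 2) / (Metric.diam Ω + 1)) H ∧
      IsResolved 𝒯 (phasePlus Ω ψ) (interface ψ) σ ρ (min r₀ (δ / 2) / (Metric.diam Ω + 1)) H := by
  set κ := min r₀ (δ / 2) / (Metric.diam Ω + 1) with hκ
  have hD : 0 < Metric.diam Ω + 1 := by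
    have := Metric.diam_nonneg (s := Ω)
    positivity
  have hκ0 : 0 < κ := by positivity
  have hsub : {x | ψ x ≤ 0} ⊆ Ω := (Metric.self_subset_cthickening _).trans hδ
  have key : ∀ H, 0 < H → (∀ s ∈ 𝒯.elements, (cell s ∩ interface ψ).Nonempty → H / ρ ≤ size s) →
      (∀ s ∈ 𝒯.elements, (cell s ∩ interface ψ).Nonempty → size s ≤ ρ * H) →
      ((interface ψ).Nonempty → H ≤ Metric.diam Ω) →
      IsResolved 𝒯 (phaseMinus ψ) (interface ψ) σ ρ κ H ∧
      IsResolved 𝒯 (phasePlus Ω ψ) (interface ψ) σ ρ κ H := by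
    intro H hH h1 h2 h3
    have h4 : ∀ x ∈ interface ψ, κ * H ≤ min r₀ (δ / 2) := fun x hx => by
      have := h3 ⟨x, hx⟩
      rw [hκ, div_mul_eq_mul_div, div_le_iff₀ hD]
      exact mul_le_mul_of_nonneg_left (by linarith) (by positivity)
    constructor
    · exact
        { shape := hsh, σ_pos := hσ, ρ_pos := hρ, κ_pos := hκ0, H_pos := hH, le_size := h1
          size_le := h2
          cone := fun x hx => (hcone x hx).1.mono ((h4 x hx).trans (min_le_left _ _))
          subset := fun x hx => subset_closure (hsub (show ψ x ≤ 0 from le_of_lt hx))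
          isOpen := isOpen_lt hψ continuous_const
          cell_subset := fun s _ hs => (cell_subset_of_sign hψ hs).1 }
    · exact
        { shape := hsh, σ_pos := hσ, ρ_pos := hρ, κ_pos := hκ0, H_pos := hH, le_size := h1
          size_le := h2
          cone := fun x hx => ((hcone x hx).2.phasePlus hx hδ).mono (h4 x hx)
          subset := fun x hx => subset_closure hx.1
          isOpen := hΩ.inter (isOpen_lt continuous_const hψ)
          cell_subset := fun s hsel hs hne x hx => ⟨𝒯.cell_subset s hsel hx,
            (cell_subset_of_sign hψ hs).2 (hne.mono (inter_subset_inter_right _ fun _ h => h.2)) hx⟩ }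
  rcases (cutElements 𝒯 (interface ψ)).eq_empty_or_nonempty with hem | ⟨T, hT⟩
  · have hno : ∀ s ∈ 𝒯.elements, ¬ (cell s ∩ interface ψ).Nonempty := fun s hs h => by
      have := mem_cutElements_of_crossed hs h
      rw [hem] at this
      simp at this
    -- Without cut elements the size bounds are vacuous and any `H` works; the closed elements cover
    -- `Ω`, so the interface is empty.
    refine ⟨1, key 1 one_pos (fun s hs h => absurd h (hno s hs)) (fun s hs h => absurd h (hno s hs)) ?_⟩
    rintro ⟨x, hx⟩
    have hxΩ : x ∈ closure Ω := subset_closure (hsub (le_of_eq hx))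
    rw [← 𝒯.cover] at hxΩ
    obtain ⟨s, hs, hxs⟩ := mem_iUnion₂.1 hxΩ
    rw [← 𝒯.closure_cell hs] at hxs
    have : s ∈ cutElements 𝒯 (interface ψ) := mem_cutElements.2 ⟨hs, x, hxs, hx⟩
    rw [hem] at this
    simp at this
  · have hTel := (mem_cutElements.1 hT).1
    -- Any cut element serves as the reference size, by quasi-uniformity. As `H ≤ diam Ω`, the
    -- normalization of `κ` keeps `κ * H` below the available cone size.
    refine ⟨size T, key _ (𝒯.size_pos (by omega) hTel) (fun s hs h => ?_) (fun s hs h => ?_)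
      fun _ => 𝒯.size_le_diam hTel⟩
    · rw [div_le_iff₀ hρ, mul_comm]
      exact hqu T hT s (mem_cutElements_of_crossed hs h)
    · exact hqu s (mem_cutElements_of_crossed hs h) T hT

/-! ### Coercivity -/

open Classical in
/-- The elements crossed by `Γ`. -/
noncomputable def crossedElements (𝒯 : Triangulation Ω) (Γ : Set (Pt d)) : Finset (Finset (Pt d)) :=
  𝒯.elements.filter fun s => (cell s ∩ Γ).Nonempty

lemma mem_crossedElements {𝒯 : Triangulation Ω} {Γ : Set (Pt d)} {s : Finset (Pt d)} :
    s ∈ crossedElements 𝒯 Γ ↔ s ∈ 𝒯.elements ∧ (cell s ∩ Γ).Nonempty := by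
  simp [crossedElements]

/-- The assumption on element boundaries lets surface integrals split into open cells, where the
finite element functions are polynomials. -/
lemma ae_mem_crossedElements {ψ : Pt d → ℝ} (hψ : Continuous ψ) (𝒯 : Triangulation Ω)
    (hΓ : interface ψ ⊆ Ω) {μ : Measure (Pt d)}
    (hnull : ∀ s ∈ 𝒯.elements, μ (interface ψ ∩ frontier (cell s)) = 0) :
    ∀ᵐ x ∂μ.restrict (interface ψ), x ∈ ⋃ s ∈ crossedElements 𝒯 (interface ψ), cell s := by
  have hm : MeasurableSet (interface ψ) := (isClosed_eq hψ continuous_const).measurableSet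
  rw [ae_restrict_iff' hm]
  have h1 : μ (⋃ s ∈ 𝒯.elements, interface ψ ∩ frontier (cell s)) = 0 :=
    (measure_biUnion_null_iff 𝒯.elements.countable_toSet).2 hnull
  filter_upwards [compl_mem_ae_iff.2 h1] with x hx hxΓ
  have hxΩ : x ∈ closure Ω := subset_closure (hΓ hxΓ)
  rw [← 𝒯.cover] at hxΩ
  obtain ⟨s, hs, hxs⟩ := mem_iUnion₂.1 hxΩ
  rw [← 𝒯.closure_cell hs] at hxs
  have hxc : x ∈ cell s := by
    by_contra h
    refine hx (mem_iUnion₂.2 ⟨s, hs, hxΓ, hxs, fun h2 => h (interior_subset h2)⟩)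
  exact mem_iUnion₂.2 ⟨s, mem_crossedElements.2 ⟨hs, x, hxc, hxΓ⟩, hxc⟩

lemma integral_eq_sum_cells {𝒯 : Triangulation Ω} {ν : Measure (Pt d)} {E : Finset (Finset (Pt d))}
    (hE : E ⊆ 𝒯.elements) (hν : ∀ᵐ x ∂ν, x ∈ ⋃ s ∈ E, cell s) {g : Pt d → ℝ}
    (hg : ∀ s ∈ E, IntegrableOn g (cell s) ν) :
    ∫ x, g x ∂ν = ∑ s ∈ E, ∫ x in cell s, g x ∂ν := by
  rw [← integral_biUnion_finset _ (fun s _ => (isOpen_cell s).measurableSet)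
    (fun s hs t ht hst => 𝒯.disjoint_cell (hE hs) (hE ht) hst) hg,
    Measure.restrict_eq_self_of_ae_mem hν]

/-- Young's inequality for integrals of products. -/
lemma four_mul_integral_mul_le {α : Type*} [MeasurableSpace α] {μ : Measure α} {a b : α → ℝ}
    (ha : MemLp a 2 μ) (hb : MemLp b 2 μ) {t : ℝ} (ht : 0 < t) :
    4 * ∫ x, a x * b x ∂μ ≤ 2 * t * (∫ x, a x ^ 2 ∂μ) + 2 / t * ∫ x, b x ^ 2 ∂μ := by
  rw [← integral_const_mul, ← integral_const_mul, ← integral_const_mul,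
    ← integral_add (ha.integrable_sq.const_mul _) (hb.integrable_sq.const_mul _)]
  refine integral_mono ((ha.integrable_mul hb).const_mul 4)
    ((ha.integrable_sq.const_mul _).add (hb.integrable_sq.const_mul _)) fun x => ?_
  have h1 : 2 * t * a x ^ 2 + 2 / t * b x ^ 2 - 4 * (a x * b x) = 2 / t * (t * a x - b x) ^ 2 := by
    field_simp
    ring
  have h2 : 0 ≤ 2 / t * (t * a x - b x) ^ 2 := by positivity
  change 4 * (a x * b x) ≤ 2 * t * a x ^ 2 + 2 / t * b x ^ 2
  linarith

/-- Bookkeeping of the absorption, with `h` standing for the inverse mesh size. The ghost estimate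
gives `c₁ * Lm ≤ 2 * A + γum * Gm`. Half of the left side pays for the strain part of Young's
inequality, since `2 * η * C₂ = c₁ / 2`, and half remains. Likewise `γ ≥ 4 / η` pays for `2 / η * W`
and leaves as much. The outer phase needs no absorption. -/
lemma coercivity_arithmetic {C₁ C₂ c₁ η γ γum γup μm μp f A B Gm Gp Lm Lp Am Bp P X Y W h : ℝ}
    (hc₁ : 0 < c₁) (hη : 0 < η) (hηC : 2 * η * C₂ = c₁ / 2) (hγ : 4 / η ≤ γ)
    (hγum : c₁ * C₁ ≤ γum) (hγup : c₁ * C₁ ≤ γup) (hc2 : c₁ * C₁ ≤ 2)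
    (hμm : 0 < μm) (hμ : μm ≤ μp) (hf : 0 ≤ f)
    (hA : 0 ≤ A) (hB : 0 ≤ B) (hGm : 0 ≤ Gm) (hGp : 0 ≤ Gp) (hAm : 0 ≤ Am) (hBp : 0 ≤ Bp)
    (hP : 0 ≤ P) (hLm : Lm ≤ C₁ * (A + Gm)) (hLp : Lp ≤ C₁ * (B + Gp)) (hAL : Am ≤ Lm)
    (hBL : Bp ≤ Lp) (hX : 4 * X ≤ 2 * η * C₂ * Lm + 2 / η * W) (hYW : h * Y ≤ W) (hW : 0 ≤ W)
    (hY : 0 ≤ h * Y) :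
    min (c₁ / 2) (min (2 / η) 1) * (μm * Am + μp * Bp + h * (μm * Y) + f * P) ≤
      2 * (μm * A) + 2 * (μp * B) + f * P - 4 * (μm * X) + γ * μm * W +
        (μm * (γum * Gm) + μp * (γup * Gp)) := by
  set c := min (c₁ / 2) (min (2 / η) 1) with hc
  have hμp : 0 < μp := hμm.trans_le hμ
  have e1 : c ≤ c₁ / 2 := min_le_left _ _
  have e2 : c ≤ 2 / η := (min_le_right _ _).trans (min_le_left _ _)
  have e3 : c ≤ 1 := (min_le_right _ _).trans (min_le_right _ _)
  have h1 : c₁ * Lm ≤ 2 * A + γum * Gm := by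
    have := mul_le_mul_of_nonneg_left hLm hc₁.le
    nlinarith
  have h2 : c₁ * Lp ≤ 2 * B + γup * Gp := by
    have := mul_le_mul_of_nonneg_left hLp hc₁.le
    nlinarith
  have h3 : c * Am ≤ c₁ / 2 * Lm := mul_le_mul e1 hAL hAm (by positivity)
  have h4 : c * Bp ≤ c₁ * Lp :=
    mul_le_mul (by linarith) hBL hBp hc₁.le
  have h5 : c * (h * Y) ≤ 2 / η * W := mul_le_mul e2 hYW hY (by positivity)
  have h6 : c * (f * P) ≤ f * P := mul_le_of_le_one_left (by positivity) e3
  have h7 : 4 / η * W ≤ γ * W := mul_le_mul_of_nonneg_right hγ hW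
  have h8 : 4 / η * W = 2 / η * W + 2 / η * W := by ring
  rw [hηC] at hX
  have h9 : c * Am + c * (h * Y) ≤ 2 * A - 4 * X + γ * W + γum * Gm := by linarith
  have h10 : c * Bp ≤ 2 * B + γup * Gp := h4.trans h2
  have h11 := mul_le_mul_of_nonneg_left h9 hμm.le
  have h12 := mul_le_mul_of_nonneg_left h10 hμp.le
  linarith

end TwoPhaseStokes

/-! ### Assembly of the coercivity estimate -/

open TwoPhaseStokes in
theorem lemma2 (d : ℕ) (hd : d = 2 ∨ d = 3) (k : ℕ) (hk : 1 ≤ k)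
    -- the domain and the shape of the interface
    (Ω : Set (Pt d)) (hΩo : IsOpen Ω) (hΩc : IsConnected Ω)
    (φ : Pt d → ℝ) (hφ : ContDiff ℝ 2 φ) (hφ0 : ∀ x, φ x = 0 → gradient φ x ≠ 0)
    -- distance to the outer boundary, mesh regularity constants, ghost penalty parameters
    (δ σ ρ γum γup : ℝ) (hδ : 0 < δ) (hσ : 0 < σ) (hρ : 0 < ρ) (hγum : 0 < γum) (hγup : 0 < γup) :
    ∃ γ₀ > 0, ∃ C > 0, ∀ γ ≥ γ₀,
      -- all positions of the interface: `ψ` is the level set function of the moved interface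
      ∀ g : Pt d ≃ᵃⁱ[ℝ] Pt d, ∀ ψ : Pt d → ℝ, ψ = φ ∘ g →
        Metric.cthickening δ {x | ψ x ≤ 0} ⊆ Ω →
      -- all meshes
      ∀ 𝒯 : Triangulation Ω, ShapeRegular σ 𝒯 → CutQuasiUniform ρ 𝒯 (interface ψ) →
        (∀ s ∈ 𝒯.elements, μHE[d - 1] (interface ψ ∩ frontier (cell s)) = 0) →
      -- all viscosities and slip coefficients
      ∀ μm μp f : ℝ, 0 < μm → μm ≤ μp → 0 ≤ f →
      ∀ u : Field d, IsVh (k + 1) 𝒯 ψ u →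
        ∀ c : Params, c = { μm := μm, μp := μp, f := f, γ := γ, γum := γum, γup := γup,
                            α := 0, β := 1 } →
          aH c (k + 1) 𝒯 ψ u u ≥ C * energySq c 𝒯 ψ u := by
  have hd2 : 2 ≤ d := by omega
  have hφ1 : ContDiff ℝ 1 φ := hφ.of_le (by norm_num)
  by_cases hb : Bornology.IsBounded {x | φ x ≤ 0}
  swap
  -- A triangulated `Ω` is bounded, so an unbounded `{φ ≤ 0}` admits no position inside it and the
  -- claim is vacuous.
  · refine ⟨1, one_pos, 1, one_pos, ?_⟩
    rintro γ - g ψ rfl hψ 𝒯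
    refine absurd ?_ hb
    have h1 : Bornology.IsBounded {x | (φ ∘ g) x ≤ 0} :=
      𝒯.isBounded.subset ((Metric.self_subset_cthickening _).trans hψ)
    refine (g.isometry.lipschitz.isBounded_image h1).subset fun x hx => ⟨g.symm x, ?_, by simp⟩
    simpa using hx
  obtain ⟨r₀, hr₀, A, hA, hgeo⟩ := exists_interface_geometry hφ1 hφ0 hb
  have hD : 0 ≤ Metric.diam Ω := Metric.diam_nonneg
  set κ := min r₀ (δ / 2) / (Metric.diam Ω + 1) with hκ
  have hκ0 : 0 < κ := by positivity
  obtain ⟨C₁, hC₁, hghost⟩ := exists_ghost_bound (k + 1) hd2 hσ hρ hκ0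
  obtain ⟨C₂, hC₂, htrace⟩ := exists_trace_bound (k + 1) hd2 hσ hA
  -- Chosen so that `c₁ * C₁` is below both the factor 2 of the strain terms and the ghost
  -- parameters; `η` then solves `2 * η * C₂ = c₁ / 2`.
  set c₁ := min 2 (min γum γup) / C₁ with hc₁
  have hc₁0 : 0 < c₁ := by positivity
  set η := c₁ / (4 * C₂) with hη
  have hη0 : 0 < η := by positivity
  refine ⟨4 / η, by positivity, min (c₁ / 2) (min (2 / η) 1), by positivity, ?_⟩
  rintro γ hγ g ψ hψ hψδ 𝒯 hsh hqu hnull μm μp f hμm hμ hf u hu c rfl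
  obtain ⟨hcone, hmeas⟩ := hgeo g
  rw [← hψ] at hcone hmeas
  have hψ1 : ContDiff ℝ 1 ψ := by
    rw [hψ]
    exact hφ1.comp g.toContinuousAffineEquiv.toContinuousAffineMap.contDiff
  have hψc := hψ1.continuous
  obtain ⟨H, hresm, hresp⟩ := exists_isResolved hd2 hψc hΩo hδ hσ hρ hr₀ hcone hψδ 𝒯 hsh hqu
  have hum : IsPiecewisePoly (k + 1) 𝒯 (phaseMinus ψ) u.minus := hu.1.2
  have hup : IsPiecewisePoly (k + 1) 𝒯 (phasePlus Ω ψ) u.plus := hu.2.2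
  set Γ := interface ψ with hΓ
  have hΓΩ : Γ ⊆ Ω := fun x hx =>
    hψδ (Metric.self_subset_cthickening _ (show ψ x ≤ 0 from le_of_eq hx))
  set ν : Measure (Pt d) := (μHE[d - 1] : Measure (Pt d)).restrict Γ with hν
  have hνball : ∀ y r, 0 ≤ r → ν (Metric.closedBall y r) ≤ ENNReal.ofReal (A * r ^ (d - 1)) := by
    intro y r hr
    rw [hν, Measure.restrict_apply Metric.isClosed_closedBall.measurableSet, inter_comm]
    exact hmeas y r hr
  have hνfin : IsFiniteMeasure ν := by
    obtain ⟨R, hR⟩ := 𝒯.isBounded.subset_closedBall 0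
    refine ⟨?_⟩
    rw [hν, Measure.restrict_apply_univ]
    have h1 : Γ ∩ Metric.closedBall 0 (max R 0) = Γ :=
      inter_eq_left.2 ((hΓΩ.trans hR).trans (Metric.closedBall_subset_closedBall (le_max_left _ _)))
    rw [← h1]
    exact (hmeas 0 _ (le_max_right _ _)).trans_lt ENNReal.ofReal_lt_top
  -- The cones put every point of the interface in the closure of both phases, so both components
  -- are polynomial on a crossed cell.
  have hcr : ∀ s ∈ crossedElements 𝒯 Γ,
      s ∈ elementsMeeting 𝒯 (phaseMinus ψ) ∧ s ∈ elementsMeeting 𝒯 (phasePlus Ω ψ) := by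
    intro s hs
    obtain ⟨hsel, x, hxs, hxΓ⟩ := mem_crossedElements.1 hs
    have hpos : 0 < κ * H := mul_pos hκ0 hresm.H_pos
    exact ⟨mem_elementsMeeting.2 ⟨hsel, mem_closure_iff.1
      ((hresm.cone x hxΓ).mem_closure hpos) _ (isOpen_cell s) hxs⟩,
      mem_elementsMeeting.2 ⟨hsel, mem_closure_iff.1
      ((hresp.cone x hxΓ).mem_closure hpos) _ (isOpen_cell s) hxs⟩⟩
  set E := crossedElements 𝒯 Γ with hE
  have hEel : E ⊆ 𝒯.elements := fun s hs => (mem_crossedElements.1 hs).1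
  have hae : ∀ᵐ x ∂ν, x ∈ ⋃ s ∈ E, cell s := ae_mem_crossedElements hψc 𝒯 hΓΩ hnull
  have hS : ∀ s ∈ E, MemLp (normalStrain ψ u.minus) 2 (ν.restrict (cell s)) := fun s hs =>
    hum.memLp_normalStrain hψ1 (hcr s hs).1
  have hJ : ∀ s ∈ E, MemLp (jumpNormal ψ u) 2 (ν.restrict (cell s)) := fun s hs =>
    memLp_jumpNormal hum hup hψ1 (hcr s hs).1 (hcr s hs).2
  have hspos : ∀ s ∈ E, 0 < size s := fun s hs => 𝒯.size_pos (by omega) (hEel hs)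
  set W := ∑ s ∈ E, (∫ x in cell s, jumpNormal ψ u x ^ 2 ∂ν) / size s with hW
  have hY : ∫ x, jumpNormal ψ u x ^ 2 ∂ν = ∑ s ∈ E, ∫ x in cell s, jumpNormal ψ u x ^ 2 ∂ν :=
    integral_eq_sum_cells hEel hae fun s hs => (hJ s hs).integrable_sq
  have hX : ∫ x, normalStrain ψ u.minus x * jumpNormal ψ u x ∂ν =
      ∑ s ∈ E, ∫ x in cell s, normalStrain ψ u.minus x * jumpNormal ψ u x ∂ν :=
    integral_eq_sum_cells hEel hae fun s hs => (hS s hs).integrable_mul (hJ s hs)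
  set Lm := ∑ s ∈ elementsMeeting 𝒯 (phaseMinus ψ),
    ∫ y in cell s, frob (symGrad u.minus y) (symGrad u.minus y) with hLm
  have hXle : 4 * ∫ x, normalStrain ψ u.minus x * jumpNormal ψ u x ∂ν ≤
      2 * η * C₂ * Lm + 2 / η * W := by
    rw [hX, Finset.mul_sum]
    have h1 : ∀ s ∈ E, 4 * ∫ x in cell s, normalStrain ψ u.minus x * jumpNormal ψ u x ∂ν ≤
        2 * η * C₂ * (∫ y in cell s, frob (symGrad u.minus y) (symGrad u.minus y)) +
          2 / η * ((∫ x in cell s, jumpNormal ψ u x ^ 2 ∂ν) / size s) := by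
      intro s hs
      -- The Young parameter `η * size s` supplies the power of the element size that the trace
      -- inequality requires.
      have h2 := four_mul_integral_mul_le (hS s hs) (hJ s hs) (mul_pos hη0 (hspos s hs))
      have h3 := htrace Ω 𝒯 _ hsh _ hum ψ ν hνball s (hcr s hs).1
      have h4 := mul_le_mul_of_nonneg_left h3 (by positivity : 0 ≤ 2 * η)
      refine h2.trans (add_le_add (le_trans (le_of_eq ?_) (h4.trans_eq ?_)) (le_of_eq ?_))
      · ring
      · ring
      · field_simp
    refine (Finset.sum_le_sum h1).trans ?_
    rw [Finset.sum_add_distrib, ← Finset.mul_sum, ← Finset.mul_sum]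
    refine add_le_add_left (mul_le_mul_of_nonneg_left ?_ (by positivity)) _
    exact Finset.sum_le_sum_of_subset_of_nonneg (fun s hs => (hcr s hs).1)
      fun s _ _ => integral_nonneg fun _ => frob_self_nonneg _
  have hYW : (meshSize 𝒯)⁻¹ * ∫ x, jumpNormal ψ u x ^ 2 ∂ν ≤ W := by
    rw [hY, Finset.mul_sum]
    refine Finset.sum_le_sum fun s hs => ?_
    rw [div_eq_inv_mul]
    -- Only `size s ≤ h` is needed: the local penalty weights dominate the global `h⁻¹`.
    exact mul_le_mul_of_nonneg_right
      (inv_anti₀ (hspos s hs) (𝒯.size_le_meshSize (hEel hs))) (integral_nonneg fun _ => sq_nonneg _)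
  have hW0 : 0 ≤ W := Finset.sum_nonneg fun s hs =>
    div_nonneg (integral_nonneg fun _ => sq_nonneg _) (hspos s hs).le
  have hcut : ∑ s ∈ cutElements 𝒯 Γ, γ / size s * μm *
      ∫ x in Γ ∩ cell s, jumpNormal ψ u x * jumpNormal ψ u x ∂μHE[d - 1] = γ * μm * W := by
    have h1 : E ⊆ cutElements 𝒯 Γ := fun s hs =>
      mem_cutElements_of_crossed (mem_crossedElements.1 hs).1 (mem_crossedElements.1 hs).2
    rw [← Finset.sum_subset h1 fun s hs hsE => ?_]
    · rw [hW, Finset.mul_sum]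
      refine Finset.sum_congr rfl fun s _ => ?_
      rw [hν, Measure.restrict_restrict (isOpen_cell s).measurableSet, inter_comm (cell s)]
      simp only [sq]
      ring
    -- Elements touched by the interface only along their boundary contribute nothing to the Nitsche
    -- sum.
    · have h2 : Γ ∩ cell s = ∅ := by
        rw [inter_comm]
        exact not_nonempty_iff_eq_empty.1 fun h =>
          hsE (mem_crossedElements.2 ⟨(mem_cutElements.1 hs).1, h⟩)
      rw [h2]
      simp
  have hmesh : 0 ≤ (meshSize 𝒯)⁻¹ :=
    inv_nonneg.2 (Real.sSup_nonneg (by rintro _ ⟨s, -, rfl⟩; exact size_nonneg s))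
  have hG : ∀ ω v, 0 ≤ ghostForm 1 (k + 1) 𝒯 ω Γ v v := fun ω v => by
    rw [ghostForm_self]
    have := Finset.sum_nonneg fun p (_ : p ∈ facetPairs 𝒯 ω Γ) => ghostTerm_nonneg (k + 1) v p
    positivity
  have hGγ : ∀ γ' ω v, ghostForm γ' (k + 1) 𝒯 ω Γ v v = γ' * ghostForm 1 (k + 1) 𝒯 ω Γ v v :=
    fun γ' ω v => by rw [ghostForm_self, ghostForm_self, one_mul]
  have hfrob : ∀ U (v : Pt d → Pt d), 0 ≤ ∫ x in U, frob (symGrad v x) (symGrad v x) := fun U v =>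
    integral_nonneg fun _ => frob_self_nonneg _
  have hcC : c₁ * C₁ = min 2 (min γum γup) := div_mul_cancel₀ _ hC₁.ne'
  have main := coercivity_arithmetic (C₁ := C₁) (γum := γum) (γup := γup) hc₁0 hη0
    (by rw [hη]; field_simp; ring) hγ (hcC.le.trans ((min_le_right _ _).trans (min_le_left _ _)))
    (hcC.le.trans ((min_le_right _ _).trans (min_le_right _ _))) (hcC.le.trans (min_le_left _ _))
    hμm hμ hf (hfrob (phaseMinus ψ) u.minus) (hfrob (phasePlus Ω ψ) u.plus)
    (hG (phaseMinus ψ) u.minus) (hG (phasePlus Ω ψ) u.plus)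
    (hfrob (extDomain 𝒯 (phaseMinus ψ)) u.minus) (hfrob (extDomain 𝒯 (phasePlus Ω ψ)) u.plus)
    (integral_nonneg fun x => sq_nonneg ‖jumpTang ψ u x‖ : 0 ≤ ∫ x, ‖jumpTang ψ u x‖ ^ 2 ∂ν)
    (hghost Ω 𝒯 _ Γ H hresm _ hum) (hghost Ω 𝒯 _ Γ H hresp _ hup)
    (hum.setIntegral_le_sum extDomain_ae_le) (hup.setIntegral_le_sum extDomain_ae_le)
    hXle hYW hW0 (mul_nonneg hmesh (integral_nonneg fun _ => sq_nonneg _))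
  -- The weights `α = 0`, `β = 1` remove the outer flux.
  have havg : ∀ x, avgFlux ⟨μm, μp, f, γ, γum, γup, 0, 1⟩ ψ u x = μm * normalStrain ψ u.minus x :=
    fun x => by simp [avgFlux, Params.avg]
  have hsq : ∀ x, (√μm * jumpNormal ψ u x) ^ 2 = μm * jumpNormal ψ u x ^ 2 := fun x => by
    rw [mul_pow, Real.sq_sqrt hμm.le]
  have hen : energySq ⟨μm, μp, f, γ, γum, γup, 0, 1⟩ 𝒯 ψ u =
      μm * (∫ x in extDomain 𝒯 (phaseMinus ψ), frob (symGrad u.minus x) (symGrad u.minus x)) +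
      μp * (∫ x in extDomain 𝒯 (phasePlus Ω ψ), frob (symGrad u.plus x) (symGrad u.plus x)) +
      (meshSize 𝒯)⁻¹ * (μm * ∫ x, jumpNormal ψ u x ^ 2 ∂ν) +
      f * ∫ x, ‖jumpTang ψ u x‖ ^ 2 ∂ν := by
    simp only [energySq, Params.avg, zero_mul, one_mul, zero_add, hsq, integral_const_mul]
    rfl
  have haH : aH ⟨μm, μp, f, γ, γum, γup, 0, 1⟩ (k + 1) 𝒯 ψ u u =
      2 * (μm * ∫ x in phaseMinus ψ, frob (symGrad u.minus x) (symGrad u.minus x)) +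
      2 * (μp * ∫ x in phasePlus Ω ψ, frob (symGrad u.plus x) (symGrad u.plus x)) +
      f * (∫ x, ‖jumpTang ψ u x‖ ^ 2 ∂ν) -
      4 * (μm * ∫ x, normalStrain ψ u.minus x * jumpNormal ψ u x ∂ν) + γ * μm * W +
      (μm * (γum * ghostForm 1 (k + 1) 𝒯 (phaseMinus ψ) Γ u.minus u.minus) +
        μp * (γup * ghostForm 1 (k + 1) 𝒯 (phasePlus Ω ψ) Γ u.plus u.plus)) := by
    simp only [aH, aI, aN, aP, havg, real_inner_self_eq_norm_sq, integral_const_mul, mul_assoc,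
      Params.avg, zero_mul, one_mul, zero_add]
    simp only [mul_assoc] at hcut
    rw [← hΓ, hcut, hGγ γum, hGγ γup]
    ring
  rw [ge_iff_le, hen, haH]
  exact main
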